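/- Let $G$ be a Lie group, let $p:P\to M$ be a smooth right principal $G$-bundle endowed with a $G$-invariant Poisson structure $\pi_P$ (every right translation $y\mapsto y\cdot g$ is a Poisson map of $(P,\pi_P)$), and let $G$ act smoothly on the left of a non-empty Poisson manifold $(X,\pi_X)$ by Poisson diffeomorphisms. Let $\Sigma:=P\times_G X$ be the associated bundle, i.e. the quotient of $P\times X$ by the action $g\cdot(y,x)=(yg^{-1},gx)$, with quotient map $q:P\times X\to\Sigma$ and projection $p_\Sigma:\Sigma\to M$, $[y,x]\mapsto p(y)$. All manifolds are finite-dimensional, smooth and without boundary. A *Poisson submersion* is a surjective submersion between Poisson manifolds that is a Poisson map. For a Poisson submersion $f:(N,\pi_N)\to(B,\pi_B)$ write $V=\ker f_*\subset TN$, $V^\circ\subset T^*N$ for its annihilator, and $\pi_N^\sharp:T^*N\to TN$ for the contraction with $\pi_N$. It is *coregular* if each fibre $F=f^{-1}(b)$ is a coregular submanifold, i.e. $\pi_N^\sharp(V^\circ)|_F$ is a smooth vector subbundle of $TN|_F$ that meets $TF=V|_F$ trivially. It is an *orthogonal pencil* if $\pi_N=\pi_V+\pi_H$ for Poisson structures $\pi_V,\pi_H$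 on $N$ with $[\pi_V,\pi_H]=0$, where $\pi_V\in\Gamma(\wedge^2V)$ and $\pi_H^\sharp(T^*N)\cap V=0$. Then there exist Poisson structures $\pi_M$ on $M$ and $\pi_\Sigma$ on $\Sigma$ such that the four maps $$q:(P,\pi_P)\times(X,\pi_X)\to(\Sigma,\pi_\Sigma),\quad \mathrm{pr}_1:(P,\pi_P)\times(X,\pi_X)\to(P,\pi_P),\quad p:(P,\pi_P)\to(M,\pi_M),\quad p_\Sigma:(\Sigma,\pi_\Sigma)\to(M,\pi_M)$$ are all Poisson submersions. Moreover, if $p:(P,\pi_P)\to(M,\pi_M)$ is coregular, then so is $p_\Sigma:(\Sigma,\pi_\Sigma)\to(M,\pi_M)$; and if $p:(P,\pi_P)\to(M,\pi_M)$ is an orthogonal pencil, then so is $p_\Sigma:(\Sigma,\pi_\Sigma)\to(M,\pi_M)$. -/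

import Mathlib

open Set Manifold Topology
open scoped ContDiff

/-! ### Bivector fields, Poisson structures and Poisson submersions -/

section Poisson

variable {E : Type*} [NormedAddCommGroup E] [NormedSpace ℝ E]
  {H : Type*} [TopologicalSpace H] (I : ModelWithCorners ℝ E H)
  (M : Type*) [TopologicalSpace M] [ChartedSpace H M]
  {E' : Type*} [NormedAddCommGroup E'] [NormedSpace ℝ E']
  {H' : Type*} [TopologicalSpace H'] (I' : ModelWithCorners ℝ E' H')
  (M' : Type*) [TopologicalSpace M'] [ChartedSpace H' M']

/-- The cotangent space `T*ₓM`. -/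
abbrev CotangentSpace {M : Type*} [TopologicalSpace M] [ChartedSpace H M] (x : M) : Type _ :=
  TangentSpace I x →L[ℝ] ℝ

/-- A (pointwise) contravariant 2-tensor field `π` on `M`, given by `π♯ : T*M → TM`,
with `π(ξ, η) = η (π♯ ξ)`. It is a bivector field when it is skew and smooth
(`Bivector.IsSkew`, `Bivector.IsSmooth`). -/
abbrev Bivector : Type _ := ∀ x : M, CotangentSpace I x →ₗ[ℝ] TangentSpace I x

variable {I M I' M'}

/-- The differential of a real function at a point, as a covector. -/
noncomputable def dAt (I : ModelWithCorners ℝ E H) (f : M → ℝ) (x : M) : CotangentSpace I x :=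
  mfderiv I 𝓘(ℝ, ℝ) f x

namespace Bivector

/-- The bracket `{f, g} = π(df, dg)`. -/
noncomputable def bracket (π : Bivector I M) (f g : M → ℝ) : M → ℝ :=
  fun x => dAt I g x (π x (dAt I f x))

/-- `π` is skew-symmetric (equivalently alternating), i.e. a section of `∧²TM`. -/
def IsSkew (π : Bivector I M) : Prop :=
  ∀ (x : M) (ξ : CotangentSpace I x), ξ (π x ξ) = 0

/-- `π` is smooth: `π(df, dg)` is smooth for all locally defined smooth functions `f`, `g`
(with coordinate functions for `f` and `g`, these are the components of `π` in a chart). -/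
def IsSmooth (π : Bivector I M) : Prop :=
  ∀ W : Set M, IsOpen W → ∀ f g : M → ℝ,
    ContMDiffOn I 𝓘(ℝ, ℝ) ∞ f W → ContMDiffOn I 𝓘(ℝ, ℝ) ∞ g W →
      ContMDiffOn I 𝓘(ℝ, ℝ) ∞ (π.bracket f g) W

/-- The cyclic sum `{f, {g, h}'} + {g, {h, f}'} + {h, {f, g}'}`. -/
noncomputable def jacobiator (π π' : Bivector I M) (f g h : M → ℝ) : M → ℝ := fun x =>
  π.bracket f (π'.bracket g h) x + π.bracket g (π'.bracket h f) x +
    π.bracket h (π'.bracket f g) x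

/-- The Schouten bracket `[π, π']` vanishes. Up to a universal sign, `[π, π'](df, dg, dh)` is
`jacobiator π π' f g h + jacobiator π' π f g h`. -/
def SchoutenCommute (π π' : Bivector I M) : Prop :=
  ∀ W : Set M, IsOpen W → ∀ f g h : M → ℝ,
    ContMDiffOn I 𝓘(ℝ, ℝ) ∞ f W → ContMDiffOn I 𝓘(ℝ, ℝ) ∞ g W →
      ContMDiffOn I 𝓘(ℝ, ℝ) ∞ h W →
        ∀ x ∈ W, jacobiator π π' f g h x + jacobiator π' π f g h x = 0

/-- A Poisson structure: a smooth bivector field with `[π, π] = 0`. -/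
structure IsPoisson (π : Bivector I M) : Prop where
  skew : π.IsSkew
  smooth : π.IsSmooth
  schouten_self : π.SchoutenCommute π

/-- The restriction of covectors on `M × M'` to the first factor of `T(M × M') = TM × TM'`. -/
noncomputable def restrictFst (z : M × M') :
    CotangentSpace (I.prod I') z →ₗ[ℝ] CotangentSpace I z.1 where
  toFun := fun ξ : E × E' →L[ℝ] ℝ => ξ.comp (ContinuousLinearMap.inl ℝ E E')
  map_add' := fun _ _ => rfl
  map_smul' := fun _ _ => rfl

/-- The restriction of covectors on `M × M'` to the second factor of `T(M × M') = TM × TM'`. -/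
noncomputable def restrictSnd (z : M × M') :
    CotangentSpace (I.prod I') z →ₗ[ℝ] CotangentSpace I' z.2 where
  toFun := fun ξ : E × E' →L[ℝ] ℝ => ξ.comp (ContinuousLinearMap.inr ℝ E E')
  map_add' := fun _ _ => rfl
  map_smul' := fun _ _ => rfl

/-- The product bivector `(π, π')` on `M × M'`: `(π, π')♯ ξ = (π♯ (ξ|TM), π'♯ (ξ|TM'))`. -/
noncomputable def prod (π : Bivector I M) (π' : Bivector I' M') :
    Bivector (I.prod I') (M × M') := fun z =>
  LinearMap.prod ((π z.1).comp (restrictFst z)) ((π' z.2).comp (restrictSnd z))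

end Bivector

/-- The pullback `φ* : T*_{φ x}M' → T*ₓM` of covectors. -/
noncomputable def covectorPullback (I : ModelWithCorners ℝ E H) (I' : ModelWithCorners ℝ E' H')
    (φ : M → M') (x : M) (ξ : CotangentSpace I' (φ x)) : CotangentSpace I x :=
  ξ.comp (mfderiv I I' φ x)

/-- `φ : (M, π) → (M', π')` is a Poisson map: it is smooth and `φ_* π♯ φ^* = π'♯`. -/
structure IsPoissonMap (φ : M → M') (π : Bivector I M) (π' : Bivector I' M') : Prop where
  smooth : ContMDiff I I' ∞ φ
  map_sharp : ∀ (x : M) (ξ : CotangentSpace I' (φ x)),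
    mfderiv I I' φ x (π x (covectorPullback I I' φ x ξ)) = π' (φ x) ξ

/-- A Poisson submersion: a surjective submersion between Poisson manifolds which is a
Poisson map. -/
structure IsPoissonSubmersion (p : M → M') (π : Bivector I M) (π' : Bivector I' M') : Prop where
  isPoisson_source : π.IsPoisson
  isPoisson_target : π'.IsPoisson
  surjective : Function.Surjective p
  submersion : ∀ x : M, Function.Surjective (mfderiv I I' p x)
  isPoissonMap : IsPoissonMap p π π'

/-- The vertical space `Vₓ = ker p_*` of a submersion, which is also the tangent space at `x`
to the fibre of `p` through `x`. -/
noncomputable def verticalSpace (I : ModelWithCorners ℝ E H) (I' : ModelWithCorners ℝ E' H')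
    (p : M → M') (x : M) : Submodule ℝ (TangentSpace I x) :=
  LinearMap.ker (mfderiv I I' p x).toLinearMap

/-- The annihilator `V° ⊆ T*ₓM` of a subspace `V ⊆ TₓM`. -/
def annihilatorAt {x : M} (V : Submodule ℝ (TangentSpace I x)) :
    Submodule ℝ (CotangentSpace I x) where
  carrier := {ξ | ∀ v ∈ V, ξ v = 0}
  add_mem' := fun {ξ η} hξ hη v hv => by
    rw [add_apply, hξ v hv, hη v hv, add_zero]
  zero_mem' := fun _ _ => rfl
  smul_mem' := fun c ξ hξ v hv => by
    rw [smul_apply, hξ v hv, smul_zero]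

/-- A family `F` of subspaces of the tangent spaces is a smooth vector subbundle of `TM|_S`,
where `S` is an embedded submanifold: near each point of `S` it has a smooth frame (smooth
sections of `TM|_S` are locally the restrictions of smooth vector fields on `M`). -/
def IsSubbundleAlong [IsManifold I ∞ M] (S : Set M)
    (F : ∀ x : M, Submodule ℝ (TangentSpace I x)) : Prop :=
  ∀ x₀ ∈ S, ∃ W : Set M, IsOpen W ∧ x₀ ∈ W ∧
    ∃ (k : ℕ) (s : Fin k → ∀ x : M, TangentSpace I x),
      (∀ i, ContMDiffOn I I.tangent ∞ (fun x => (⟨x, s i x⟩ : TangentBundle I M)) W) ∧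
      ∀ x ∈ S ∩ W, LinearIndependent ℝ (fun i => s i x) ∧
        Submodule.span ℝ (Set.range fun i => s i x) = F x

/-- An embedded submanifold `S` with tangent spaces `T x ⊆ TₓM`, `x ∈ S`, is coregular in
`(M, π)`: the family `π♯(N*S)`, with `N*ₓS = (TₓS)°`, is a vector subbundle of `TM|_S` which
meets `TS` trivially. -/
structure IsCoregularSubmanifold [IsManifold I ∞ M] (π : Bivector I M) (S : Set M)
    (T : ∀ x : M, Submodule ℝ (TangentSpace I x)) : Prop where
  subbundle : IsSubbundleAlong S fun x => (annihilatorAt (T x)).map (π x)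
  trivial_inter : ∀ x ∈ S, (annihilatorAt (T x)).map (π x) ⊓ T x = ⊥

/-- A coregular Poisson submersion: a Poisson submersion whose fibres are coregular. -/
structure IsCoregularSubmersion [IsManifold I ∞ M] (p : M → M') (π : Bivector I M)
    (π' : Bivector I' M') : Prop where
  isPoissonSubmersion : IsPoissonSubmersion p π π'
  coregular_fibres : ∀ m : M', IsCoregularSubmanifold π (p ⁻¹' {m}) (verticalSpace I I' p)

/-- An orthogonal pencil: a Poisson submersion `p` in which `π` splits as a sum of commuting
Poisson structures `π_V + π_H`, with `π_V` vertical and `π_H♯(T*M) ∩ V = 0`. -/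
structure IsOrthogonalPencil (p : M → M') (π : Bivector I M) (π' : Bivector I' M') : Prop where
  isPoissonSubmersion : IsPoissonSubmersion p π π'
  exists_splitting : ∃ πV πH : Bivector I M,
    πV.IsPoisson ∧ πH.IsPoisson ∧ πV.SchoutenCommute πH ∧
    (∀ x : M, π x = πV x + πH x) ∧
    (∀ x : M, LinearMap.range (πV x) ≤ verticalSpace I I' p x) ∧
    (∀ x : M, LinearMap.range (πH x) ⊓ verticalSpace I I' p x = ⊥)

end Poisson

/-! ### Principal bundles and associated bundles -/

section Bundles

variable {EG : Type*} [NormedAddCommGroup EG] [NormedSpace ℝ EG]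
  {HG : Type*} [TopologicalSpace HG] (IG : ModelWithCorners ℝ EG HG)
  {EP : Type*} [NormedAddCommGroup EP] [NormedSpace ℝ EP]
  {HP : Type*} [TopologicalSpace HP] (IP : ModelWithCorners ℝ EP HP)
  {EM : Type*} [NormedAddCommGroup EM] [NormedSpace ℝ EM]
  {HM : Type*} [TopologicalSpace HM] (IM : ModelWithCorners ℝ EM HM)
  {EX : Type*} [NormedAddCommGroup EX] [NormedSpace ℝ EX]
  {HX : Type*} [TopologicalSpace HX] (IX : ModelWithCorners ℝ EX HX)
  {G : Type*} [Group G] [TopologicalSpace G] [ChartedSpace HG G]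
  {P : Type*} [TopologicalSpace P] [ChartedSpace HP P] [MulAction Gᵐᵒᵖ P]
  {M : Type*} [TopologicalSpace M] [ChartedSpace HM M]
  (X : Type*) [TopologicalSpace X] [ChartedSpace HX X] [MulAction G X]

/-- A smooth `G`-equivariant local trivialization `p⁻¹(U) ≅ U × G`; the right action
`y · g` of `G` on `P` is written `MulOpposite.op g • y`. -/
structure IsPrincipalTrivialization {p : P → M} (e : Bundle.Trivialization G p) : Prop where
  contMDiffOn_toFun : ContMDiffOn IP (IM.prod IG) ∞ e e.source
  contMDiffOn_symm : ContMDiffOn (IM.prod IG) IP ∞ e.toOpenPartialHomeomorph.symm e.target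
  map_smul : ∀ y ∈ e.source, ∀ g : G, (e (MulOpposite.op g • y)).2 = (e y).2 * g

/-- `p : P → M` is a smooth right principal `G`-bundle: `G` acts smoothly on `P` on the right
along the fibres of `p`, and `p` has smooth equivariant local trivializations. -/
structure IsPrincipalBundle (p : P → M) : Prop where
  contMDiff_action : ContMDiff (IP.prod IG) IP ∞ fun z : P × G => MulOpposite.op z.2 • z.1
  map_smul : ∀ (y : P) (g : G), p (MulOpposite.op g • y) = p y
  exists_trivialization : ∀ m : M, ∃ e : Bundle.Trivialization G p,
    m ∈ e.baseSet ∧ IsPrincipalTrivialization IG IP IM e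

/-- The orbit relation of the action `g · (y, x) = (y g⁻¹, g x)` of `G` on `P × X`. -/
def associatedSetoid (G P X : Type*) [Group G] [MulAction Gᵐᵒᵖ P] [MulAction G X] :
    Setoid (P × X) where
  r a b := ∃ g : G, b = (MulOpposite.op g⁻¹ • a.1, g • a.2)
  iseqv :=
    { refl := fun a => ⟨1, by simp⟩
      symm := by
        rintro a _ ⟨g, rfl⟩
        exact ⟨g⁻¹, by simp [smul_smul]⟩
      trans := by
        rintro a _ _ ⟨g, rfl⟩ ⟨g', rfl⟩
        exact ⟨g' * g, by simp only [smul_smul, ← MulOpposite.op_mul, mul_inv_rev]⟩ }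

variable {IG IP IM}

/-- The associated bundle `Σ = P ×_G X` of a principal `G`-bundle and a smooth left action of `G`
on `X`, with the quotient topology. -/
def AssociatedBundle {p : P → M} (_hp : IsPrincipalBundle IG IP IM (G := G) p)
    (IX : ModelWithCorners ℝ EX HX) (X : Type*) [TopologicalSpace X] [ChartedSpace HX X]
    [MulAction G X] [ContMDiffSMul IG IX ∞ G X] : Type _ :=
  Quotient (associatedSetoid G P X)

namespace AssociatedBundle

variable {p : P → M} (hp : IsPrincipalBundle IG IP IM (G := G) p) [ContMDiffSMul IG IX ∞ G X]

instance : TopologicalSpace (AssociatedBundle hp IX X) :=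
  inferInstanceAs (TopologicalSpace (Quotient (associatedSetoid G P X)))

/-- The quotient map `q : P × X → Σ`. -/
def mk (z : P × X) : AssociatedBundle hp IX X := Quotient.mk (associatedSetoid G P X) z

/-- The bundle projection `Σ → M`, `[y, x] ↦ p y`. -/
def proj : AssociatedBundle hp IX X → M :=
  Quotient.lift (fun z : P × X => p z.1) (by
    rintro a _ ⟨g, rfl⟩
    exact (hp.map_smul _ _).symm)

variable {IX X}

lemma isQuotientMap_mk : IsQuotientMap (mk IX X hp) := isQuotientMap_quotient_mk'

lemma mk_smul (g : G) (y : P) (x : X) :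
    mk IX X hp (MulOpposite.op g⁻¹ • y, g • x) = mk IX X hp (y, x) :=
  (Quotient.sound (s := associatedSetoid G P X) (a := (y, x)) ⟨g, rfl⟩).symm

/-- The map `[y, x] ↦ (p y, g x)`, where `e y = (p y, g)`. -/
noncomputable def chartFun (e : Bundle.Trivialization G p) (z : AssociatedBundle hp IX X) :
    M × X :=
  (p (Quotient.out z).1, (e (Quotient.out z).1).2 • (Quotient.out z).2)

lemma chartFun_mk {e : Bundle.Trivialization G p} (he : IsPrincipalTrivialization IG IP IM e)
    {y : P} (hy : p y ∈ e.baseSet) (x : X) :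
    chartFun hp e (mk IX X hp (y, x)) = (p y, (e y).2 • x) := by
  obtain ⟨g, hg⟩ := Quotient.mk_out (s := associatedSetoid G P X) (y, x)
  have hg' : (y, x) = (MulOpposite.op g⁻¹ • (Quotient.out (mk IX X hp (y, x))).1,
    g • (Quotient.out (mk IX X hp (y, x))).2) := hg
  obtain ⟨h1, h2⟩ := Prod.mk.inj hg'
  have h3 : p (Quotient.out (mk IX X hp (y, x))).1 = p y := by
    conv_rhs => rw [h1, hp.map_smul]
  have h4 : (Quotient.out (mk IX X hp (y, x))).1 ∈ e.source := by
    rw [e.mem_source, h3]; exact hy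
  refine Prod.ext h3 ?_
  have h5 := he.map_smul _ h4 g⁻¹
  rw [← h1] at h5
  calc (e (Quotient.out (mk IX X hp (y, x))).1).2 • (Quotient.out (mk IX X hp (y, x))).2
      = (e y).2 • (g • (Quotient.out (mk IX X hp (y, x))).2) := by
        rw [h5, smul_smul, inv_mul_cancel_right]
    _ = (e y).2 • x := congrArg _ h2.symm

/-- The local trivialization `Σ|_U ≅ U × X` induced by a local trivialization of `P` over `U`. -/
noncomputable def trivChart {e : Bundle.Trivialization G p}
    (he : IsPrincipalTrivialization IG IP IM e) :
    OpenPartialHomeomorph (AssociatedBundle hp IX X) (M × X) where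
  toFun := chartFun hp e
  invFun := fun w => mk IX X hp (e.toOpenPartialHomeomorph.symm (w.1, 1), w.2)
  source := proj IX X hp ⁻¹' e.baseSet
  target := e.baseSet ×ˢ univ
  map_source' := by
    rintro ⟨y, x⟩ hz
    change chartFun hp e (mk IX X hp (y, x)) ∈ _
    rw [chartFun_mk hp he (show p y ∈ e.baseSet from hz)]
    exact ⟨hz, mem_univ _⟩
  map_target' := by
    rintro ⟨u, x⟩ ⟨hu, -⟩
    change p (e.toOpenPartialHomeomorph.symm (u, 1)) ∈ e.baseSet
    rw [e.proj_symm_apply' hu]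
    exact hu
  left_inv' := by
    rintro ⟨y, x⟩ hz
    have hy : p y ∈ e.baseSet := hz
    have hys : y ∈ e.source := e.mem_source.2 hy
    change (fun w : M × X => mk IX X hp (e.toOpenPartialHomeomorph.symm (w.1, 1), w.2))
      (chartFun hp e (mk IX X hp (y, x))) = mk IX X hp (y, x)
    rw [chartFun_mk hp he hy, ← mk_smul hp (e y).2 y x]
    have h1 : MulOpposite.op (e y).2⁻¹ • y ∈ e.source := by
      rw [e.mem_source, hp.map_smul]; exact hy
    have h2 : e (MulOpposite.op (e y).2⁻¹ • y) = (p y, 1) := by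
      refine Prod.ext ?_ ?_
      · rw [e.coe_fst h1, hp.map_smul]
      · rw [he.map_smul y hys, mul_inv_cancel]
    change mk IX X hp (e.toOpenPartialHomeomorph.symm (p y, 1), _) = _
    rw [← h2]
    congr 2
    exact e.toOpenPartialHomeomorph.left_inv h1
  right_inv' := by
    rintro ⟨u, x⟩ ⟨hu, -⟩
    have h1 : p (e.toOpenPartialHomeomorph.symm (u, 1)) ∈ e.baseSet := by
      rw [e.proj_symm_apply' hu]; exact hu
    change chartFun hp e (mk IX X hp (e.toOpenPartialHomeomorph.symm (u, 1), x)) = (u, x)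
    rw [chartFun_mk hp he h1, e.apply_symm_apply' hu, e.proj_symm_apply' hu, one_smul]
  open_source := by
    rw [← (isQuotientMap_mk (IX := IX) (X := X) hp).isOpen_preimage]
    have : mk IX X hp ⁻¹' (proj IX X hp ⁻¹' e.baseSet) = e.source ×ˢ univ := by
      ext ⟨y, x⟩
      simp only [mem_preimage, mem_prod, mem_univ, and_true, e.mem_source]
      rfl
    rw [this]
    exact e.open_source.prod isOpen_univ
  open_target := e.open_baseSet.prod isOpen_univ
  continuousOn_toFun := by
    have : ContinuousSMul G X := ContMDiffSMul.continuousSMul (I := IG) (I' := IX) ∞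
    have hpre : mk IX X hp ⁻¹' (proj IX X hp ⁻¹' e.baseSet) = e.source ×ˢ univ := by
      ext ⟨y, x⟩
      simp only [mem_preimage, mem_prod, mem_univ, and_true, e.mem_source]
      rfl
    have ho : IsOpen (proj IX X hp ⁻¹' e.baseSet) := by
      rw [← (isQuotientMap_mk (IX := IX) (X := X) hp).isOpen_preimage, hpre]
      exact e.open_source.prod isOpen_univ
    rw [(isQuotientMap_mk (IX := IX) (X := X) hp).continuousOn_isOpen_iff ho, hpre]
    have h1 : ContinuousOn (fun z : P × X => e z.1) (e.source ×ˢ univ) :=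
      e.toOpenPartialHomeomorph.continuousOn.comp continuousOn_fst fun z hz => hz.1
    have h2 : ContinuousOn (fun z : P × X => ((e z.1).1, (e z.1).2 • z.2))
        (e.source ×ˢ univ) :=
      (continuous_fst.comp_continuousOn h1).prodMk
        ((continuous_snd.comp_continuousOn h1).smul continuousOn_snd)
    refine h2.congr ?_
    rintro ⟨y, x⟩ ⟨hy, -⟩
    change chartFun hp e (mk IX X hp (y, x)) = _
    rw [chartFun_mk hp he (e.mem_source.1 hy)]
    exact Prod.ext (e.coe_fst hy).symm rfl
  continuousOn_invFun := by
    refine (isQuotientMap_mk hp).continuous.comp_continuousOn ?_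
    refine ContinuousOn.prodMk ?_ continuousOn_snd
    refine e.toOpenPartialHomeomorph.symm.continuousOn.comp
      (continuousOn_fst.prodMk continuousOn_const) ?_
    rintro ⟨u, x⟩ ⟨hu, -⟩
    exact e.mem_target.2 hu

/-- The associated bundle as a space locally homeomorphic to `M × X`. -/
@[reducible] noncomputable def prodChartedSpace :
    ChartedSpace (M × X) (AssociatedBundle hp IX X) where
  atlas := {c | ∃ (e : Bundle.Trivialization G p) (he : IsPrincipalTrivialization IG IP IM e),
    c = trivChart hp he}
  chartAt z := trivChart hp (hp.exists_trivialization (proj IX X hp z)).choose_spec.2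
  mem_chart_source z := (hp.exists_trivialization (proj IX X hp z)).choose_spec.1
  chart_mem_atlas _ := ⟨_, _, rfl⟩

/-- The atlas of the associated bundle: local trivializations `Σ|_U ≅ U × X` followed by products
of charts of `M` and `X`. -/
noncomputable instance : ChartedSpace (ModelProd HM HX) (AssociatedBundle hp IX X) :=
  letI := prodChartedSpace (IX := IX) (X := X) hp
  ChartedSpace.comp (ModelProd HM HX) (M × X) (AssociatedBundle hp IX X)

instance [IsManifold IM ∞ M] [IsManifold IX ∞ X] :
    IsManifold (IM.prod IX) ∞ (AssociatedBundle hp IX X) := by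
  set I₀ := IM.prod IX
  refine isManifold_of_contDiffOn _ _ _ ?_
  rintro _ _ ⟨_, ⟨e, he, rfl⟩, c, hc, rfl⟩ ⟨_, ⟨e', he', rfl⟩, c', hc', rfl⟩
  set φ : OpenPartialHomeomorph (AssociatedBundle hp IX X) (M × X) := trivChart hp he
  set φ' : OpenPartialHomeomorph (AssociatedBundle hp IX X) (M × X) := trivChart hp he'
  have hφ : ContMDiffOn (IM.prod IX) (IM.prod IX) ∞ (φ' ∘ φ.symm)
      ((e.baseSet ∩ e'.baseSet) ×ˢ univ) := by
    have h1 : ContMDiffOn (IM.prod IX) (IM.prod IG) ∞ (fun w : M × X => (w.1, (1 : G)))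
        ((e.baseSet ∩ e'.baseSet) ×ˢ univ) :=
      contMDiffOn_fst.prodMk contMDiffOn_const
    have h2 : ContMDiffOn (IM.prod IX) IP ∞
        (fun w : M × X => e.toOpenPartialHomeomorph.symm (w.1, (1 : G)))
        ((e.baseSet ∩ e'.baseSet) ×ˢ univ) :=
      he.contMDiffOn_symm.comp h1 fun w hw => e.mem_target.2 hw.1.1
    have h3 : ContMDiffOn (IM.prod IX) (IM.prod IG) ∞
        (fun w : M × X => e' (e.toOpenPartialHomeomorph.symm (w.1, (1 : G))))
        ((e.baseSet ∩ e'.baseSet) ×ˢ univ) :=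
      he'.contMDiffOn_toFun.comp h2 fun w hw => by
        rw [mem_preimage, e'.mem_source, e.proj_symm_apply' hw.1.1]
        exact hw.1.2
    have h4 := contMDiffOn_fst.prodMk
      ((contMDiff_snd.comp_contMDiffOn h3).smul (I := IG) (I' := IX) contMDiffOn_snd)
    refine h4.congr ?_
    rintro ⟨u, x⟩ ⟨⟨hu, hu'⟩, -⟩
    change chartFun hp e' (mk IX X hp (e.toOpenPartialHomeomorph.symm (u, 1), x)) = _
    rw [chartFun_mk hp he' (by rw [e.proj_symm_apply' hu]; exact hu'), e.proj_symm_apply' hu]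
    rfl
  have hc2 := IsManifold.subset_maximalAtlas (I := IM.prod IX) (n := ∞) hc
  have hc2' := IsManifold.subset_maximalAtlas (I := IM.prod IX) (n := ∞) hc'
  have h := (contMDiffOn_iff_of_mem_maximalAtlas (s := c.source ∩
    (((e.baseSet ∩ e'.baseSet) ×ˢ univ) ∩ (φ' ∘ φ.symm) ⁻¹' c'.source)) hc2 hc2'
    inter_subset_left (fun w hw => hw.2.2)).1
    (hφ.mono (inter_subset_right.trans inter_subset_left))
  refine h.2.mono ?_
  rintro w ⟨hw, hwI⟩
  have hw1 : I₀.symm w ∈ (φ.trans c).target := hw.1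
  rw [OpenPartialHomeomorph.trans_target] at hw1
  have hw2 : φ.symm (c.symm (I₀.symm w)) ∈ (φ'.trans c').source := hw.2
  rw [OpenPartialHomeomorph.trans_source] at hw2
  have hb : (c.symm (I₀.symm w)).1 ∈ e.baseSet := hw1.2.1
  have hb' : p (e.toOpenPartialHomeomorph.symm ((c.symm (I₀.symm w)).1, 1)) ∈ e'.baseSet := hw2.1
  rw [e.proj_symm_apply' hb] at hb'
  refine ⟨c.symm (I₀.symm w), ⟨c.map_target hw1.1, ⟨⟨hb, hb'⟩, mem_univ _⟩, hw2.2⟩, ?_⟩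
  change I₀ (c (c.symm (I₀.symm w))) = w
  rw [c.right_inv hw1.1, I₀.right_inv hwI]

end AssociatedBundle

end Bundles

set_option linter.unusedSectionVars false

/-! ### Linear algebra of skew tensors -/

section LinearAlgebra

variable {E : Type*} [NormedAddCommGroup E] [NormedSpace ℝ E]

lemma skew_apply_comm {B : (E →L[ℝ] ℝ) →ₗ[ℝ] E} (hB : ∀ ξ : E →L[ℝ] ℝ, ξ (B ξ) = 0) (ξ η : E →L[ℝ] ℝ) :
    η (B ξ) = -ξ (B η) := by
  have h := hB (ξ + η)
  simp only [map_add, add_apply, hB] at h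
  linarith

lemma eq_of_forall_clm_apply_eq {v w : E} (h : ∀ ξ : E →L[ℝ] ℝ, ξ v = ξ w) : v = w :=
  (SeparatingDual.eq_iff_forall_dual_eq (R := ℝ)).2 h

lemma skew_apply_eq_zero {A : (E →L[ℝ] ℝ) →ₗ[ℝ] E} (hA : ∀ ξ : E →L[ℝ] ℝ, ξ (A ξ) = 0)
    {ξ : E →L[ℝ] ℝ} (hξ : ∀ v ∈ LinearMap.range A, ξ v = 0) : A ξ = 0 := by
  refine eq_of_forall_clm_apply_eq fun η => ?_
  rw [skew_apply_comm hA, hξ _ ⟨η, rfl⟩, map_zero, neg_zero]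

/-- A functional which vanishes on the kernel of a surjective map factors through it. -/
lemma exists_clm_comp_eq {E' : Type*} [NormedAddCommGroup E'] [NormedSpace ℝ E']
    [FiniteDimensional ℝ E'] (T : E →L[ℝ] E') (hT : Function.Surjective T) (ζ : E →L[ℝ] ℝ)
    (hζ : ∀ v, T v = 0 → ζ v = 0) : ∃ ξ : E' →L[ℝ] ℝ, ζ = ξ.comp T := by
  obtain ⟨S, hS⟩ := T.toLinearMap.exists_rightInverse_of_surjective (LinearMap.range_eq_top.2 hT)
  refine ⟨ζ.comp (LinearMap.toContinuousLinearMap S), ?_⟩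
  ext v
  have h : T (S (T v) - v) = 0 := by
    rw [map_sub, sub_eq_zero]
    exact LinearMap.congr_fun hS (T v)
  have := hζ _ h
  rw [map_sub, sub_eq_zero] at this
  simpa using this.symm

variable [FiniteDimensional ℝ E]

/-- A functional on `W` extends to a functional which vanishes on `V` if `W ∩ V = 0`. -/
lemma exists_clm_eqOn_of_disjoint {W V : Submodule ℝ E} (h : W ⊓ V = ⊥) (ζ : E →L[ℝ] ℝ) :
    ∃ ξ : E →L[ℝ] ℝ, (∀ v ∈ V, ξ v = 0) ∧ ∀ w ∈ W, ξ w = ζ w := by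
  obtain ⟨K, hVK, hK⟩ := (disjoint_iff.2 ((inf_comm V W).trans h)).exists_isCompl
  let pr : E →ₗ[ℝ] E := W.subtype ∘ₗ Submodule.projectionOnto W K hK.symm
  refine ⟨ζ.comp (LinearMap.toContinuousLinearMap pr), fun v hv => ?_, fun w hw => ?_⟩
  · have : pr v = 0 := by
      simp [pr, Submodule.projectionOnto_apply_right hK.symm ⟨v, hVK hv⟩]
    simp [this]
  · have : pr w = w := by
      have := Submodule.projectionOnto_apply_left hK.symm ⟨w, hw⟩
      simp only [pr, LinearMap.comp_apply]
      rw [this]; rfl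
    simp [this]

/-- Uniqueness of the splitting of a skew tensor in a part tangent to `V` and a part whose range
meets `V` trivially. -/
lemma skew_splitting_unique {V : Submodule ℝ E} {A A' B B' : (E →L[ℝ] ℝ) →ₗ[ℝ] E}
    (hA : ∀ ξ : E →L[ℝ] ℝ, ξ (A ξ) = 0) (hA' : ∀ ξ : E →L[ℝ] ℝ, ξ (A' ξ) = 0)
    (hB : ∀ ξ : E →L[ℝ] ℝ, ξ (B ξ) = 0) (hB' : ∀ ξ : E →L[ℝ] ℝ, ξ (B' ξ) = 0)
    (hAV : LinearMap.range A ≤ V) (hAV' : LinearMap.range A' ≤ V)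
    (hBV : LinearMap.range B ⊓ V = ⊥) (hBV' : LinearMap.range B' ⊓ V = ⊥)
    (h : A + B = A' + B') : B = B' := by
  have hV : ∀ ξ : E →L[ℝ] ℝ, (∀ v ∈ V, ξ v = 0) → B ξ = B' ξ := by
    intro ξ hξ
    have h1 := LinearMap.congr_fun h ξ
    simpa [skew_apply_eq_zero hA fun v hv => hξ v (hAV hv),
      skew_apply_eq_zero hA' fun v hv => hξ v (hAV' hv)] using h1
  have key : ∀ {B B' : (E →L[ℝ] ℝ) →ₗ[ℝ] E}, (∀ ξ : E →L[ℝ] ℝ, ξ (B ξ) = 0) → LinearMap.range B ⊓ V = ⊥ →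
      (∀ ξ : E →L[ℝ] ℝ, (∀ v ∈ V, ξ v = 0) → B ξ = B' ξ) →
      LinearMap.range B ≤ LinearMap.range B' := by
    rintro B B' hB hBV hV _ ⟨ζ, rfl⟩
    obtain ⟨ξ, hξV, hξW⟩ := exists_clm_eqOn_of_disjoint hBV ζ
    have h1 : B (ξ - ζ) = 0 :=
      skew_apply_eq_zero hB fun v hv => by rw [sub_apply, hξW v hv, sub_self]
    rw [map_sub, sub_eq_zero] at h1
    exact ⟨ξ, by rw [← h1, hV ξ hξV]⟩
  have hr' := key hB' hBV' fun ξ hξ => (hV ξ hξ).symm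
  ext1 ζ
  obtain ⟨ξ, hξV, hξW⟩ := exists_clm_eqOn_of_disjoint hBV ζ
  have h1 : B (ξ - ζ) = 0 :=
    skew_apply_eq_zero hB fun v hv => by rw [sub_apply, hξW v hv, sub_self]
  have h2 : B' (ξ - ζ) = 0 :=
    skew_apply_eq_zero hB' fun v hv => by rw [sub_apply, hξW v (hr' hv), sub_self]
  rw [map_sub, sub_eq_zero] at h1 h2
  rw [← h1, ← h2, hV ξ hξV]

end LinearAlgebra

/-! ### The Schouten bracket in a vector space -/

section VectorSpace

variable {E : Type*} [NormedAddCommGroup E] [NormedSpace ℝ E]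

/-- The part of the Schouten bracket of two 2-tensor fields on a vector space that comes from
one of the two nested brackets. -/
noncomputable def halfSchouten (a b : E → (E →L[ℝ] ℝ) →L[ℝ] E) (u : E) (ξ η ζ : E →L[ℝ] ℝ) : ℝ :=
  ζ (fderiv ℝ b u (a u ξ) η) + ξ (fderiv ℝ b u (a u η) ζ) + η (fderiv ℝ b u (a u ζ) ξ)

lemma fderiv_bracket {b : E → (E →L[ℝ] ℝ) →L[ℝ] E} {G H : E → ℝ} {u : E}
    (hb : DifferentiableAt ℝ b u) (hskew : ∀ ξ : E →L[ℝ] ℝ, ξ (b u ξ) = 0)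
    (hG : ContDiffAt ℝ ∞ G u) (hH : ContDiffAt ℝ ∞ H u) (w : E) :
    fderiv ℝ (fun v => fderiv ℝ H v (b v (fderiv ℝ G v))) u w =
      fderiv ℝ (fderiv ℝ H) u w (b u (fderiv ℝ G u))
        - fderiv ℝ (fderiv ℝ G) u w (b u (fderiv ℝ H u))
        + fderiv ℝ H u (fderiv ℝ b u w (fderiv ℝ G u)) := by
  have hd : ∀ {F : E → ℝ}, ContDiffAt ℝ ∞ F u → DifferentiableAt ℝ (fderiv ℝ F) u := fun hF =>
    (hF.fderiv_right (m := 1) (by norm_cast)).differentiableAt one_ne_zero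
  have h := (hd hH).hasFDerivAt.clm_apply (hb.hasFDerivAt.clm_apply (hd hG).hasFDerivAt)
  rw [h.fderiv]
  have hs := skew_apply_comm (B := (b u).toLinearMap) hskew (fderiv ℝ (fderiv ℝ G) u w)
    (fderiv ℝ H u)
  simp only [ContinuousLinearMap.coe_coe] at hs
  simp [hs]
  ring

/-- The sum of the two cyclic sums of nested brackets is tensorial. -/
lemma halfSchouten_add_eq {a b : E → (E →L[ℝ] ℝ) →L[ℝ] E} {F G H : E → ℝ} {u : E}
    (ha : DifferentiableAt ℝ a u) (hb : DifferentiableAt ℝ b u)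
    (hsa : ∀ ξ : E →L[ℝ] ℝ, ξ (a u ξ) = 0) (hsb : ∀ ξ : E →L[ℝ] ℝ, ξ (b u ξ) = 0)
    (hF : ContDiffAt ℝ ∞ F u) (hG : ContDiffAt ℝ ∞ G u) (hH : ContDiffAt ℝ ∞ H u) :
    (fderiv ℝ (fun v => fderiv ℝ H v (b v (fderiv ℝ G v))) u (a u (fderiv ℝ F u)) +
      fderiv ℝ (fun v => fderiv ℝ F v (b v (fderiv ℝ H v))) u (a u (fderiv ℝ G u)) +
      fderiv ℝ (fun v => fderiv ℝ G v (b v (fderiv ℝ F v))) u (a u (fderiv ℝ H u))) +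
    (fderiv ℝ (fun v => fderiv ℝ H v (a v (fderiv ℝ G v))) u (b u (fderiv ℝ F u)) +
      fderiv ℝ (fun v => fderiv ℝ F v (a v (fderiv ℝ H v))) u (b u (fderiv ℝ G u)) +
      fderiv ℝ (fun v => fderiv ℝ G v (a v (fderiv ℝ F v))) u (b u (fderiv ℝ H u))) =
    halfSchouten a b u (fderiv ℝ F u) (fderiv ℝ G u) (fderiv ℝ H u) +
      halfSchouten b a u (fderiv ℝ F u) (fderiv ℝ G u) (fderiv ℝ H u) := by
  have hsym : ∀ {F : E → ℝ}, ContDiffAt ℝ ∞ F u → ∀ v w,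
      fderiv ℝ (fderiv ℝ F) u v w = fderiv ℝ (fderiv ℝ F) u w v := fun hF v w =>
    (hF.isSymmSndFDerivAt (by simpa using ENat.LEInfty.out)) v w
  rw [fderiv_bracket hb hsb hG hH, fderiv_bracket hb hsb hH hF, fderiv_bracket hb hsb hF hG,
    fderiv_bracket ha hsa hG hH, fderiv_bracket ha hsa hH hF, fderiv_bracket ha hsa hF hG,
    hsym hF (b u (fderiv ℝ G u)), hsym hF (b u (fderiv ℝ H u)), hsym hG (b u (fderiv ℝ F u)),
    hsym hG (b u (fderiv ℝ H u)), hsym hH (b u (fderiv ℝ F u)), hsym hH (b u (fderiv ℝ G u))]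
  unfold halfSchouten
  ring

end VectorSpace

/-! ### Bivector fields in charts -/

section ChartRep

variable {E : Type*} [NormedAddCommGroup E] [NormedSpace ℝ E] [FiniteDimensional ℝ E]
  {H : Type*} [TopologicalSpace H] {I : ModelWithCorners ℝ E H}
  {M : Type*} [TopologicalSpace M] [ChartedSpace H M]

namespace Bivector

/-- The representation of a bivector field in the preferred chart at `x₀`. -/
noncomputable def chartRep (π : Bivector I M) (x₀ : M) (u : E) : (E →L[ℝ] ℝ) →L[ℝ] E :=
  LinearMap.toContinuousLinearMap
    { toFun := fun ξ => mfderiv I 𝓘(ℝ, E) (extChartAt I x₀) ((extChartAt I x₀).symm u)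
        (π ((extChartAt I x₀).symm u)
          (covectorPullback I 𝓘(ℝ, E) (extChartAt I x₀) ((extChartAt I x₀).symm u) ξ))
      map_add' := fun ξ η => by
        have : covectorPullback I 𝓘(ℝ, E) (extChartAt I x₀) ((extChartAt I x₀).symm u) (ξ + η) =
          covectorPullback I 𝓘(ℝ, E) (extChartAt I x₀) ((extChartAt I x₀).symm u) ξ +
          covectorPullback I 𝓘(ℝ, E) (extChartAt I x₀) ((extChartAt I x₀).symm u) η := rfl
        rw [this, map_add, map_add]; rfl
      map_smul' := fun c ξ => by
        have : covectorPullback I 𝓘(ℝ, E) (extChartAt I x₀) ((extChartAt I x₀).symm u) (c • ξ) =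
          c • covectorPullback I 𝓘(ℝ, E) (extChartAt I x₀) ((extChartAt I x₀).symm u) ξ := rfl
        rw [this, map_smul, map_smul]; rfl }

lemma chartRep_apply (π : Bivector I M) {x₀ x : M} {u : E}
    (hx : (extChartAt I x₀).symm u = x) (ξ : E →L[ℝ] ℝ) :
    chartRep π x₀ u ξ = mfderiv I 𝓘(ℝ, E) (extChartAt I x₀) x
      (π x (covectorPullback I 𝓘(ℝ, E) (extChartAt I x₀) x ξ)) := by
  subst hx
  rfl

lemma IsSkew.chartRep {π : Bivector I M} (hπ : π.IsSkew) (x₀ : M) (u : E) (ξ : E →L[ℝ] ℝ) :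
    ξ (π.chartRep x₀ u ξ) = 0 :=
  hπ _ (covectorPullback I 𝓘(ℝ, E) (extChartAt I x₀) ((extChartAt I x₀).symm u) ξ)

end Bivector

variable [I.Boundaryless] [IsManifold I ∞ M]

lemma extChartAt_target_mem_nhds_of_mem {x₀ x : M} (hx : x ∈ (extChartAt I x₀).source) :
    (extChartAt I x₀).target ∈ 𝓝 (extChartAt I x₀ x) :=
  (isOpen_extChartAt_target x₀).mem_nhds ((extChartAt I x₀).map_source hx)

lemma contMDiffAt_extChartAt_symm_of_mem {x₀ x : M} (hx : x ∈ (extChartAt I x₀).source) :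
    ContMDiffAt 𝓘(ℝ, E) I ∞ (extChartAt I x₀).symm (extChartAt I x₀ x) :=
  (contMDiffOn_extChartAt_symm x₀).contMDiffAt (extChartAt_target_mem_nhds_of_mem hx)

lemma contMDiffAt_extChartAt_of_mem {x₀ x : M} (hx : x ∈ (extChartAt I x₀).source) :
    ContMDiffAt I 𝓘(ℝ, E) ∞ (extChartAt I x₀) x :=
  contMDiffAt_extChartAt' (by rwa [extChartAt_source] at hx)

lemma contDiffAt_comp_extChartAt_symm {f : M → ℝ} {x₀ x : M}
    (hx : x ∈ (extChartAt I x₀).source) (hf : ContMDiffAt I 𝓘(ℝ, ℝ) ∞ f x) :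
    ContDiffAt ℝ ∞ (f ∘ (extChartAt I x₀).symm) (extChartAt I x₀ x) := by
  rw [← contMDiffAt_iff_contDiffAt]
  refine ContMDiffAt.comp _ ?_ (contMDiffAt_extChartAt_symm_of_mem hx)
  rwa [(extChartAt I x₀).left_inv hx]

lemma eventually_comp_extChartAt_symm {α : Type*} (f : M → α) {x₀ x : M}
    (hx : x ∈ (extChartAt I x₀).source) :
    (f ∘ (extChartAt I x₀).symm) ∘ extChartAt I x₀ =ᶠ[𝓝 x] f := by
  filter_upwards [(isOpen_extChartAt_source x₀).mem_nhds hx] with y hy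
  rw [Function.comp_apply, Function.comp_apply, (extChartAt I x₀).left_inv hy]

lemma dAt_comp_extChartAt {F : E → ℝ} {x₀ x : M} (hx : x ∈ (extChartAt I x₀).source)
    (hF : DifferentiableAt ℝ F (extChartAt I x₀ x)) :
    dAt I (F ∘ extChartAt I x₀) x =
      covectorPullback I 𝓘(ℝ, E) (extChartAt I x₀) x
        (fderiv ℝ F (extChartAt I x₀ x) : E →L[ℝ] ℝ) := by
  unfold dAt covectorPullback
  rw [mfderiv_comp x hF.mdifferentiableAt
    ((contMDiffAt_extChartAt_of_mem hx).mdifferentiableAt (by simp)), mfderiv_eq_fderiv]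
  rfl

lemma dAt_eq_covectorPullback {f : M → ℝ} {x₀ x : M} (hx : x ∈ (extChartAt I x₀).source)
    (hf : ContMDiffAt I 𝓘(ℝ, ℝ) ∞ f x) :
    dAt I f x = covectorPullback I 𝓘(ℝ, E) (extChartAt I x₀) x
      (fderiv ℝ (f ∘ (extChartAt I x₀).symm) (extChartAt I x₀ x) : E →L[ℝ] ℝ) := by
  rw [← dAt_comp_extChartAt hx ((contDiffAt_comp_extChartAt_symm hx hf).differentiableAt (by simp))]
  exact (eventually_comp_extChartAt_symm f hx).mfderiv_eq.symm

namespace Bivector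

lemma bracket_eq_chartRep (π : Bivector I M) {f g : M → ℝ} {x₀ x : M}
    (hx : x ∈ (extChartAt I x₀).source)
    (hf : ContMDiffAt I 𝓘(ℝ, ℝ) ∞ f x) (hg : ContMDiffAt I 𝓘(ℝ, ℝ) ∞ g x) :
    π.bracket f g x = fderiv ℝ (g ∘ (extChartAt I x₀).symm) (extChartAt I x₀ x)
      (π.chartRep x₀ (extChartAt I x₀ x)
        (fderiv ℝ (f ∘ (extChartAt I x₀).symm) (extChartAt I x₀ x))) := by
  rw [chartRep_apply π ((extChartAt I x₀).left_inv hx), bracket, dAt_eq_covectorPullback hx hf,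
    dAt_eq_covectorPullback hx hg]
  rfl

lemma bracket_comp_extChartAt (π : Bivector I M) {F G : E → ℝ} {x₀ x : M}
    (hx : x ∈ (extChartAt I x₀).source) (hF : DifferentiableAt ℝ F (extChartAt I x₀ x))
    (hG : DifferentiableAt ℝ G (extChartAt I x₀ x)) :
    π.bracket (F ∘ extChartAt I x₀) (G ∘ extChartAt I x₀) x =
      fderiv ℝ G (extChartAt I x₀ x)
        (π.chartRep x₀ (extChartAt I x₀ x) (fderiv ℝ F (extChartAt I x₀ x))) := by
  rw [chartRep_apply π ((extChartAt I x₀).left_inv hx), bracket, dAt_comp_extChartAt hx hF,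
    dAt_comp_extChartAt hx hG]
  rfl

/-- Smoothness of a family of tensors can be tested on pairs of covectors. -/
lemma contDiffOn_of_forall_apply {a : E → (E →L[ℝ] ℝ) →L[ℝ] E} {s : Set E}
    (h : ∀ ξ η : E →L[ℝ] ℝ, ContDiffOn ℝ ∞ (fun u => η (a u ξ)) s) : ContDiffOn ℝ ∞ a s := by
  rw [contDiffOn_clm_apply]
  intro ξ
  let L := (Module.finBasis ℝ E).equivFunL
  rw [← L.comp_contDiffOn_iff, contDiffOn_pi]
  intro i
  exact h ξ ((ContinuousLinearMap.proj i).comp L.toContinuousLinearMap)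

lemma IsSmooth.contDiffOn_chartRep {π : Bivector I M} (hπ : π.IsSmooth) (x₀ : M) :
    ContDiffOn ℝ ∞ (π.chartRep x₀) (extChartAt I x₀).target := by
  refine contDiffOn_of_forall_apply fun ξ η => ?_
  have hs : ∀ ξ : E →L[ℝ] ℝ, ContMDiffOn I 𝓘(ℝ, ℝ) ∞ (ξ ∘ extChartAt I x₀)
      (extChartAt I x₀).source := fun ξ y hy =>
    (ξ.contDiff.contMDiff.contMDiffAt.comp y (contMDiffAt_extChartAt_of_mem hy)).contMDiffWithinAt
  have h := hπ _ (isOpen_extChartAt_source x₀) _ _ (hs ξ) (hs η)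
  rw [← contMDiffOn_iff_contDiffOn]
  refine (h.comp (contMDiffOn_extChartAt_symm x₀)
    fun u hu => (extChartAt I x₀).map_target hu).congr fun u hu => ?_
  rw [Function.comp_apply, bracket_comp_extChartAt π ((extChartAt I x₀).map_target hu)
    ξ.differentiableAt η.differentiableAt, (extChartAt I x₀).right_inv hu, ξ.fderiv, η.fderiv]

lemma IsSmooth.contDiffAt_chartRep {π : Bivector I M} (hπ : π.IsSmooth) {x₀ x : M}
    (hx : x ∈ (extChartAt I x₀).source) :
    ContDiffAt ℝ ∞ (π.chartRep x₀) (extChartAt I x₀ x) :=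
  (hπ.contDiffOn_chartRep x₀).contDiffAt (extChartAt_target_mem_nhds_of_mem hx)

lemma isSmooth_of_contDiffAt_chartRep {π : Bivector I M}
    (h : ∀ x : M, ContDiffAt ℝ ∞ (π.chartRep x) (extChartAt I x x)) : π.IsSmooth := by
  intro W hW f g hf hg x hx
  have hfx := hf.contMDiffAt (hW.mem_nhds hx)
  have hgx := hg.contMDiffAt (hW.mem_nhds hx)
  have hxs := mem_extChartAt_source (I := I) x
  have h1 := (contDiffAt_comp_extChartAt_symm hxs hgx).fderiv_right (m := ∞) (by norm_cast)
  have h2 := (contDiffAt_comp_extChartAt_symm hxs hfx).fderiv_right (m := ∞) (by norm_cast)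
  have h3 := h1.clm_apply ((h x).clm_apply h2)
  refine ContMDiffAt.contMDiffWithinAt ?_
  refine (h3.contMDiffAt.comp x (contMDiffAt_extChartAt_of_mem hxs)).congr_of_eventuallyEq ?_
  filter_upwards [hW.mem_nhds hx, (isOpen_extChartAt_source (I := I) x).mem_nhds hxs] with y hy hys
  exact bracket_eq_chartRep π hys (hf.contMDiffAt (hW.mem_nhds hy))
    (hg.contMDiffAt (hW.mem_nhds hy))

lemma bracket_bracket_eq_chartRep (π : Bivector I M) {π' : Bivector I M} (hπ' : π'.IsSmooth)
    {W : Set M} (hW : IsOpen W) {f g h : M → ℝ} (hf : ContMDiffOn I 𝓘(ℝ, ℝ) ∞ f W)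
    (hg : ContMDiffOn I 𝓘(ℝ, ℝ) ∞ g W) (hh : ContMDiffOn I 𝓘(ℝ, ℝ) ∞ h W) {x : M} (hx : x ∈ W) :
    π.bracket f (π'.bracket g h) x =
      fderiv ℝ (fun u => fderiv ℝ (h ∘ (extChartAt I x).symm) u
        (π'.chartRep x u (fderiv ℝ (g ∘ (extChartAt I x).symm) u))) (extChartAt I x x)
      (π.chartRep x (extChartAt I x x)
        (fderiv ℝ (f ∘ (extChartAt I x).symm) (extChartAt I x x))) := by
  have hxs := mem_extChartAt_source (I := I) x
  rw [bracket_eq_chartRep π hxs (hf.contMDiffAt (hW.mem_nhds hx))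
    ((hπ' W hW g h hg hh).contMDiffAt (hW.mem_nhds hx))]
  congr 1
  refine Filter.EventuallyEq.fderiv_eq ?_
  have hc : ContinuousAt (extChartAt I x).symm (extChartAt I x x) :=
    (contMDiffAt_extChartAt_symm_of_mem hxs).continuousAt
  filter_upwards [extChartAt_target_mem_nhds_of_mem hxs,
    hc.preimage_mem_nhds (by rw [(extChartAt I x).left_inv hxs]; exact hW.mem_nhds hx)] with u hu hu'
  have h1 := bracket_eq_chartRep π' ((extChartAt I x).map_target hu)
    (hg.contMDiffAt (hW.mem_nhds hu')) (hh.contMDiffAt (hW.mem_nhds hu'))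
  rw [(extChartAt I x).right_inv hu] at h1
  exact h1

lemma jacobiator_add_jacobiator_eq {π π' : Bivector I M} (hπ : π.IsSmooth) (hπ' : π'.IsSmooth)
    (hs : π.IsSkew) (hs' : π'.IsSkew)
    {W : Set M} (hW : IsOpen W) {f g h : M → ℝ} (hf : ContMDiffOn I 𝓘(ℝ, ℝ) ∞ f W)
    (hg : ContMDiffOn I 𝓘(ℝ, ℝ) ∞ g W) (hh : ContMDiffOn I 𝓘(ℝ, ℝ) ∞ h W) {x : M} (hx : x ∈ W) :
    jacobiator π π' f g h x + jacobiator π' π f g h x =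
      halfSchouten (π.chartRep x) (π'.chartRep x) (extChartAt I x x)
        (fderiv ℝ (f ∘ (extChartAt I x).symm) (extChartAt I x x))
        (fderiv ℝ (g ∘ (extChartAt I x).symm) (extChartAt I x x))
        (fderiv ℝ (h ∘ (extChartAt I x).symm) (extChartAt I x x)) +
      halfSchouten (π'.chartRep x) (π.chartRep x) (extChartAt I x x)
        (fderiv ℝ (f ∘ (extChartAt I x).symm) (extChartAt I x x))
        (fderiv ℝ (g ∘ (extChartAt I x).symm) (extChartAt I x x))
        (fderiv ℝ (h ∘ (extChartAt I x).symm) (extChartAt I x x)) := by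
  have hxs := mem_extChartAt_source (I := I) x
  have hn := hW.mem_nhds hx
  rw [← halfSchouten_add_eq ((hπ.contDiffAt_chartRep hxs).differentiableAt (by simp))
    ((hπ'.contDiffAt_chartRep hxs).differentiableAt (by simp)) (hs.chartRep x _) (hs'.chartRep x _)
    (contDiffAt_comp_extChartAt_symm hxs (hf.contMDiffAt hn))
    (contDiffAt_comp_extChartAt_symm hxs (hg.contMDiffAt hn))
    (contDiffAt_comp_extChartAt_symm hxs (hh.contMDiffAt hn))]
  unfold jacobiator
  rw [bracket_bracket_eq_chartRep π hπ' hW hf hg hh hx,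
    bracket_bracket_eq_chartRep π hπ' hW hg hh hf hx,
    bracket_bracket_eq_chartRep π hπ' hW hh hf hg hx,
    bracket_bracket_eq_chartRep π' hπ hW hf hg hh hx,
    bracket_bracket_eq_chartRep π' hπ hW hg hh hf hx,
    bracket_bracket_eq_chartRep π' hπ hW hh hf hg hx]

/-- Two smooth bivector fields commute if and only if the Schouten bracket of their chart
representations vanishes at the centre of each chart. -/
lemma schoutenCommute_iff {π π' : Bivector I M} (hπ : π.IsSmooth) (hπ' : π'.IsSmooth)
    (hs : π.IsSkew) (hs' : π'.IsSkew) :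
    π.SchoutenCommute π' ↔ ∀ (x : M) (ξ η ζ : E →L[ℝ] ℝ),
      halfSchouten (π.chartRep x) (π'.chartRep x) (extChartAt I x x) ξ η ζ +
        halfSchouten (π'.chartRep x) (π.chartRep x) (extChartAt I x x) ξ η ζ = 0 := by
  refine ⟨fun h x ξ η ζ => ?_, fun h W hW f g k hf hg hk x hx => ?_⟩
  · have hxs := mem_extChartAt_source (I := I) x
    have hsm : ∀ ξ : E →L[ℝ] ℝ, ContMDiffOn I 𝓘(ℝ, ℝ) ∞ (ξ ∘ extChartAt I x)
        (extChartAt I x).source := fun ξ y hy =>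
      (ξ.contDiff.contMDiff.contMDiffAt.comp y (contMDiffAt_extChartAt_of_mem hy)).contMDiffWithinAt
    have hd : ∀ ξ : E →L[ℝ] ℝ, fderiv ℝ ((ξ ∘ extChartAt I x) ∘ (extChartAt I x).symm)
        (extChartAt I x x) = ξ := fun ξ => by
      have h1 : (ξ ∘ extChartAt I x) ∘ (extChartAt I x).symm =ᶠ[𝓝 (extChartAt I x x)] ξ := by
        filter_upwards [extChartAt_target_mem_nhds_of_mem hxs] with u hu
        rw [Function.comp_apply, Function.comp_apply, (extChartAt I x).right_inv hu]
      rw [h1.fderiv_eq, ξ.fderiv]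
    have h1 := jacobiator_add_jacobiator_eq hπ hπ' hs hs' (isOpen_extChartAt_source x)
      (hsm ξ) (hsm η) (hsm ζ) hxs
    rw [hd, hd, hd] at h1
    rw [← h1]
    exact h _ (isOpen_extChartAt_source x) _ _ _ (hsm ξ) (hsm η) (hsm ζ) x hxs
  · rw [jacobiator_add_jacobiator_eq hπ hπ' hs hs' hW hf hg hk hx]
    exact h x _ _ _

end Bivector

end ChartRep

/-! ### Products of bivector fields -/

section ProdTensor

variable {E : Type*} [NormedAddCommGroup E] [NormedSpace ℝ E]
  {E' : Type*} [NormedAddCommGroup E'] [NormedSpace ℝ E']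

variable {F : Type*} [NormedAddCommGroup F] [NormedSpace ℝ F]
  {F' : Type*} [NormedAddCommGroup F'] [NormedSpace ℝ F']
  {D : Type*} [NormedAddCommGroup D] [NormedSpace ℝ D]

lemma HasFDerivAt.clm_fst_add_clm_snd {a : E → F} {b : E' → F'} {u : E × E'} {a' b'}
    (ha : HasFDerivAt a a' u.1) (hb : HasFDerivAt b b' u.2) (S : F →L[ℝ] D) (T : F' →L[ℝ] D) :
    HasFDerivAt (fun u : E × E' => S (a u.1) + T (b u.2))
      (S.comp (a'.comp (ContinuousLinearMap.fst ℝ E E')) +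
        T.comp (b'.comp (ContinuousLinearMap.snd ℝ E E'))) u := by
  have h1 : HasFDerivAt (fun u : E × E' => u.1) (ContinuousLinearMap.fst ℝ E E') u := hasFDerivAt_fst
  have h2 : HasFDerivAt (fun u : E × E' => u.2) (ContinuousLinearMap.snd ℝ E E') u := hasFDerivAt_snd
  exact (S.hasFDerivAt.comp u (ha.comp u h1)).add (T.hasFDerivAt.comp u (hb.comp u h2))

variable (E E') in
/-- The inclusion of 2-tensors on `E` into 2-tensors on `E × E'`. -/
noncomputable def tensorInl :
    ((E →L[ℝ] ℝ) →L[ℝ] E) →L[ℝ] ((E × E' →L[ℝ] ℝ) →L[ℝ] E × E') :=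
  ((ContinuousLinearMap.compL ℝ _ E (E × E')) (ContinuousLinearMap.inl ℝ E E')).comp
    ((ContinuousLinearMap.compL ℝ (E × E' →L[ℝ] ℝ) (E →L[ℝ] ℝ) E).flip
      ((ContinuousLinearMap.compL ℝ E (E × E') ℝ).flip (ContinuousLinearMap.inl ℝ E E')))

variable (E E') in
/-- The inclusion of 2-tensors on `E'` into 2-tensors on `E × E'`. -/
noncomputable def tensorInr :
    ((E' →L[ℝ] ℝ) →L[ℝ] E') →L[ℝ] ((E × E' →L[ℝ] ℝ) →L[ℝ] E × E') :=
  ((ContinuousLinearMap.compL ℝ _ E' (E × E')) (ContinuousLinearMap.inr ℝ E E')).comp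
    ((ContinuousLinearMap.compL ℝ (E × E' →L[ℝ] ℝ) (E' →L[ℝ] ℝ) E').flip
      ((ContinuousLinearMap.compL ℝ E' (E × E') ℝ).flip (ContinuousLinearMap.inr ℝ E E')))

/-- The product of two fields of 2-tensors on vector spaces. -/
noncomputable def prodTensor (a : E → (E →L[ℝ] ℝ) →L[ℝ] E) (b : E' → (E' →L[ℝ] ℝ) →L[ℝ] E')
    (u : E × E') : (E × E' →L[ℝ] ℝ) →L[ℝ] E × E' :=
  tensorInl E E' (a u.1) + tensorInr E E' (b u.2)

lemma prodTensor_eq (a : E → (E →L[ℝ] ℝ) →L[ℝ] E) (b : E' → (E' →L[ℝ] ℝ) →L[ℝ] E') :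
    prodTensor a b = fun u => tensorInl E E' (a u.1) + tensorInr E E' (b u.2) := rfl

lemma tensorInl_apply (a : (E →L[ℝ] ℝ) →L[ℝ] E) (ξ : E × E' →L[ℝ] ℝ) :
    tensorInl E E' a ξ = (a (ξ.comp (ContinuousLinearMap.inl ℝ E E')), 0) := rfl

lemma tensorInr_apply (b : (E' →L[ℝ] ℝ) →L[ℝ] E') (ξ : E × E' →L[ℝ] ℝ) :
    tensorInr E E' b ξ = (0, b (ξ.comp (ContinuousLinearMap.inr ℝ E E'))) := rfl

lemma prodTensor_apply (a : E → (E →L[ℝ] ℝ) →L[ℝ] E) (b : E' → (E' →L[ℝ] ℝ) →L[ℝ] E')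
    (u : E × E') (ξ : E × E' →L[ℝ] ℝ) :
    prodTensor a b u ξ = (a u.1 (ξ.comp (ContinuousLinearMap.inl ℝ E E')),
      b u.2 (ξ.comp (ContinuousLinearMap.inr ℝ E E'))) := by
  rw [prodTensor, add_apply, tensorInl_apply, tensorInr_apply, Prod.mk_add_mk, add_zero, zero_add]

lemma contDiffOn_prodTensor [FiniteDimensional ℝ E] [FiniteDimensional ℝ E']
    {a : E → (E →L[ℝ] ℝ) →L[ℝ] E} {b : E' → (E' →L[ℝ] ℝ) →L[ℝ] E'} {s : Set E} {s' : Set E'}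
    (ha : ContDiffOn ℝ ∞ a s) (hb : ContDiffOn ℝ ∞ b s') :
    ContDiffOn ℝ ∞ (prodTensor a b) (s ×ˢ s') := by
  rw [contDiffOn_clm_apply]
  intro ξ
  simp only [prodTensor_apply]
  have h1 : ContDiffOn ℝ ∞ (fun u : E × E' => a u.1) (s ×ˢ s') :=
    ha.comp contDiffOn_fst fun u hu => hu.1
  have h2 : ContDiffOn ℝ ∞ (fun u : E × E' => b u.2) (s ×ˢ s') :=
    hb.comp contDiffOn_snd fun u hu => hu.2
  exact (h1.clm_apply contDiffOn_const).prodMk (h2.clm_apply contDiffOn_const)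

lemma fderiv_prodTensor_apply {a : E → (E →L[ℝ] ℝ) →L[ℝ] E} {b : E' → (E' →L[ℝ] ℝ) →L[ℝ] E'}
    {u : E × E'} (ha : DifferentiableAt ℝ a u.1) (hb : DifferentiableAt ℝ b u.2) (w : E × E')
    (ξ : E × E' →L[ℝ] ℝ) :
    fderiv ℝ (prodTensor a b) u w ξ =
      (fderiv ℝ a u.1 w.1 (ξ.comp (ContinuousLinearMap.inl ℝ E E')),
        fderiv ℝ b u.2 w.2 (ξ.comp (ContinuousLinearMap.inr ℝ E E'))) := by
  have h := HasFDerivAt.clm_fst_add_clm_snd (F := (E →L[ℝ] ℝ) →L[ℝ] E)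
    (F' := (E' →L[ℝ] ℝ) →L[ℝ] E') (D := (E × E' →L[ℝ] ℝ) →L[ℝ] E × E') ha.hasFDerivAt hb.hasFDerivAt (tensorInl E E') (tensorInr E E')
  rw [prodTensor_eq, h.fderiv]
  simp only [add_apply, ContinuousLinearMap.comp_apply, tensorInl_apply, tensorInr_apply,
    Prod.mk_add_mk, add_zero, zero_add, ContinuousLinearMap.coe_fst', ContinuousLinearMap.coe_snd']

lemma clm_prod_apply (ξ : E × E' →L[ℝ] ℝ) (v : E) (w : E') : ξ (v, w) =
    ξ.comp (ContinuousLinearMap.inl ℝ E E') v + ξ.comp (ContinuousLinearMap.inr ℝ E E') w := by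
  simp [← map_add]

lemma halfSchouten_prodTensor {a a' : E → (E →L[ℝ] ℝ) →L[ℝ] E} {b b' : E' → (E' →L[ℝ] ℝ) →L[ℝ] E'}
    {u : E × E'} (ha : DifferentiableAt ℝ a' u.1) (hb : DifferentiableAt ℝ b' u.2)
    (ξ η ζ : E × E' →L[ℝ] ℝ) :
    halfSchouten (prodTensor a b) (prodTensor a' b') u ξ η ζ =
      halfSchouten a a' u.1 (ξ.comp (ContinuousLinearMap.inl ℝ E E'))
        (η.comp (ContinuousLinearMap.inl ℝ E E')) (ζ.comp (ContinuousLinearMap.inl ℝ E E')) +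
      halfSchouten b b' u.2 (ξ.comp (ContinuousLinearMap.inr ℝ E E'))
        (η.comp (ContinuousLinearMap.inr ℝ E E')) (ζ.comp (ContinuousLinearMap.inr ℝ E E')) := by
  simp only [halfSchouten, fderiv_prodTensor_apply ha hb, prodTensor_apply]
  rw [clm_prod_apply ξ, clm_prod_apply η, clm_prod_apply ζ]
  ring

lemma prodMap_pushforward {T : E × E' →L[ℝ] F × F'} {S : E →L[ℝ] F} {S' : E' →L[ℝ] F'}
    (hT : T = S.prodMap S') (a : (E →L[ℝ] ℝ) →ₗ[ℝ] E) (a' : (E' →L[ℝ] ℝ) →ₗ[ℝ] E')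
    (ξ : F × F' →L[ℝ] ℝ) :
    T (a ((ξ.comp T).comp (ContinuousLinearMap.inl ℝ E E')),
        a' ((ξ.comp T).comp (ContinuousLinearMap.inr ℝ E E'))) =
      (S (a ((ξ.comp (ContinuousLinearMap.inl ℝ F F')).comp S)),
        S' (a' ((ξ.comp (ContinuousLinearMap.inr ℝ F F')).comp S'))) := by
  subst hT
  refine Prod.ext (congrArg (fun ζ => S (a ζ)) ?_) (congrArg (fun ζ => S' (a' ζ)) ?_) <;>
  · ext v
    simp

end ProdTensor

section Prod

variable {E : Type*} [NormedAddCommGroup E] [NormedSpace ℝ E] [FiniteDimensional ℝ E]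
  {H : Type*} [TopologicalSpace H] {I : ModelWithCorners ℝ E H}
  {M : Type*} [TopologicalSpace M] [ChartedSpace H M]
  {E' : Type*} [NormedAddCommGroup E'] [NormedSpace ℝ E'] [FiniteDimensional ℝ E']
  {H' : Type*} [TopologicalSpace H'] {I' : ModelWithCorners ℝ E' H'}
  {M' : Type*} [TopologicalSpace M'] [ChartedSpace H' M']

namespace Bivector

lemma prod_covector_apply (z : M × M') (ξ : CotangentSpace (I.prod I') z)
    (v : TangentSpace I z.1) (w : TangentSpace I' z.2) :
    ξ (v, w) = restrictFst z ξ v + restrictSnd z ξ w :=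
  clm_prod_apply (E := E) (E' := E') ξ v w

lemma IsSkew.prod {π : Bivector I M} {π' : Bivector I' M'} (h : π.IsSkew) (h' : π'.IsSkew) :
    (π.prod π').IsSkew := fun z ξ =>
  (prod_covector_apply z ξ _ _).trans ((congrArg₂ (· + ·) (h z.1 (restrictFst z ξ))
    (h' z.2 (restrictSnd z ξ))).trans (add_zero 0))

variable [I.Boundaryless] [I'.Boundaryless]
variable [IsManifold I ∞ M] [IsManifold I' ∞ M']

lemma hasMFDerivAt_extChartAt_prod {x y : M} {x' y' : M'} (hy : y ∈ (extChartAt I x).source)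
    (hy' : y' ∈ (extChartAt I' x').source) :
    HasMFDerivAt (I.prod I') 𝓘(ℝ, E × E') (extChartAt (I.prod I') (x, x')) (y, y')
      (((mfderiv I 𝓘(ℝ, E) (extChartAt I x) y).comp (ContinuousLinearMap.fst ℝ E E')).prod
        ((mfderiv I' 𝓘(ℝ, E') (extChartAt I' x') y').comp (ContinuousLinearMap.snd ℝ E E'))) := by
  have h1 := ((contMDiffAt_extChartAt_of_mem hy).mdifferentiableAt (by simp)).hasMFDerivAt
  have h2 := ((contMDiffAt_extChartAt_of_mem hy').mdifferentiableAt (by simp)).hasMFDerivAt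
  have h3 := HasMFDerivAt.comp (f := Prod.fst) (y, y') h1
    (hasMFDerivAt_fst (I := I) (I' := I') (y, y'))
  have h4 := HasMFDerivAt.comp (f := Prod.snd) (y, y') h2
    (hasMFDerivAt_snd (I := I) (I' := I') (y, y'))
  exact ⟨h3.1.prodMk h4.1, h3.2.prodMk h4.2⟩

lemma chartRep_prod_apply (π : Bivector I M) (π' : Bivector I' M') {x : M} {x' : M'} {u : E × E'}
    (hu : u.1 ∈ (extChartAt I x).target) (hu' : u.2 ∈ (extChartAt I' x').target) :
    (π.prod π').chartRep (x, x') u = prodTensor (π.chartRep x) (π'.chartRep x') u := by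
  ext1 ξ
  have h := hasMFDerivAt_extChartAt_prod ((extChartAt I x).map_target hu)
    ((extChartAt I' x').map_target hu')
  rw [chartRep_apply (π.prod π') (x := ((extChartAt I x).symm u.1, (extChartAt I' x').symm u.2))
    (by rw [extChartAt_prod]; rfl), prodTensor_apply, chartRep_apply π rfl, chartRep_apply π' rfl]
  exact prodMap_pushforward (E := E) (E' := E') (F := E) (F' := E') h.mfderiv
    (π ((extChartAt I x).symm u.1)) (π' ((extChartAt I' x').symm u.2)) ξ

lemma chartRep_prod_eventuallyEq (π : Bivector I M) (π' : Bivector I' M') (z : M × M') :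
    (π.prod π').chartRep z =ᶠ[𝓝 (extChartAt (I.prod I') z z)]
      prodTensor (π.chartRep z.1) (π'.chartRep z.2) := by
  have h1 := extChartAt_target_mem_nhds_of_mem (mem_extChartAt_source (I := I) z.1)
  have h2 := extChartAt_target_mem_nhds_of_mem (mem_extChartAt_source (I := I') z.2)
  filter_upwards [prod_mem_nhds h1 h2] with u hu
  exact chartRep_prod_apply π π' hu.1 hu.2

lemma IsSmooth.prod {π : Bivector I M} {π' : Bivector I' M'} (h : π.IsSmooth) (h' : π'.IsSmooth) :
    (π.prod π').IsSmooth := by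
  refine isSmooth_of_contDiffAt_chartRep fun z => ?_
  refine ContDiffAt.congr_of_eventuallyEq ?_ (chartRep_prod_eventuallyEq π π' z)
  exact (contDiffOn_prodTensor (h.contDiffOn_chartRep z.1) (h'.contDiffOn_chartRep z.2)).contDiffAt
    (prod_mem_nhds (extChartAt_target_mem_nhds_of_mem (mem_extChartAt_source z.1))
      (extChartAt_target_mem_nhds_of_mem (mem_extChartAt_source z.2)))

lemma SchoutenCommute.prod {π₁ π₂ : Bivector I M} {π₁' π₂' : Bivector I' M'}
    (h₁ : π₁.IsPoisson) (h₂ : π₂.IsPoisson) (h₁' : π₁'.IsPoisson) (h₂' : π₂'.IsPoisson)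
    (h : π₁.SchoutenCommute π₂) (h' : π₁'.SchoutenCommute π₂') :
    (π₁.prod π₁').SchoutenCommute (π₂.prod π₂') := by
  rw [schoutenCommute_iff (h₁.smooth.prod h₁'.smooth) (h₂.smooth.prod h₂'.smooth)
    (h₁.skew.prod h₁'.skew) (h₂.skew.prod h₂'.skew)]
  rw [schoutenCommute_iff h₁.smooth h₂.smooth h₁.skew h₂.skew] at h
  rw [schoutenCommute_iff h₁'.smooth h₂'.smooth h₁'.skew h₂'.skew] at h'
  intro z ξ η ζ
  have hd : ∀ {π : Bivector I M}, π.IsPoisson → DifferentiableAt ℝ (π.chartRep z.1)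
      (extChartAt (I.prod I') z z).1 := fun hπ =>
    (hπ.smooth.contDiffAt_chartRep (mem_extChartAt_source z.1)).differentiableAt (by simp)
  have hd' : ∀ {π : Bivector I' M'}, π.IsPoisson → DifferentiableAt ℝ (π.chartRep z.2)
      (extChartAt (I.prod I') z z).2 := fun hπ =>
    (hπ.smooth.contDiffAt_chartRep (mem_extChartAt_source z.2)).differentiableAt (by simp)
  have key : ∀ {a a' b b' : E × E' → (E × E' →L[ℝ] ℝ) →L[ℝ] E × E'} {u : E × E'},
      a =ᶠ[𝓝 u] b → a' =ᶠ[𝓝 u] b' → halfSchouten a a' u = halfSchouten b b' u := by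
    intro a a' b b' u h1 h2
    ext ξ η ζ
    rw [halfSchouten, halfSchouten, h1.eq_of_nhds, h2.fderiv_eq]
  rw [key (chartRep_prod_eventuallyEq π₁ π₁' z) (chartRep_prod_eventuallyEq π₂ π₂' z),
    key (chartRep_prod_eventuallyEq π₂ π₂' z) (chartRep_prod_eventuallyEq π₁ π₁' z),
    halfSchouten_prodTensor (hd h₂) (hd' h₂'), halfSchouten_prodTensor (hd h₁) (hd' h₁')]
  have e := h z.1 (ξ.comp (ContinuousLinearMap.inl ℝ E E'))
        (η.comp (ContinuousLinearMap.inl ℝ E E')) (ζ.comp (ContinuousLinearMap.inl ℝ E E'))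
  have e' := h' z.2 (ξ.comp (ContinuousLinearMap.inr ℝ E E'))
        (η.comp (ContinuousLinearMap.inr ℝ E E')) (ζ.comp (ContinuousLinearMap.inr ℝ E E'))
  have e1 : (extChartAt (I.prod I') z z).1 = extChartAt I z.1 z.1 := rfl
  have e2 : (extChartAt (I.prod I') z z).2 = extChartAt I' z.2 z.2 := rfl
  rw [e1, e2]
  linarith

lemma IsPoisson.prod {π : Bivector I M} {π' : Bivector I' M'} (h : π.IsPoisson)
    (h' : π'.IsPoisson) : (π.prod π').IsPoisson :=
  ⟨h.skew.prod h'.skew, h.smooth.prod h'.smooth,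
    SchoutenCommute.prod h h h' h' h.schouten_self h'.schouten_self⟩

end Bivector

end Prod

section Zero

variable {E : Type*} [NormedAddCommGroup E] [NormedSpace ℝ E]
  {H : Type*} [TopologicalSpace H] {I : ModelWithCorners ℝ E H}
  {M : Type*} [TopologicalSpace M] [ChartedSpace H M]

namespace Bivector

lemma bracket_zero_left (f g : M → ℝ) : (0 : Bivector I M).bracket f g = fun _ => 0 := by
  ext x
  exact map_zero (dAt I g x)

lemma bracket_const_right (π : Bivector I M) (f : M → ℝ) (c : ℝ) (x : M) :
    π.bracket f (fun _ => c) x = 0 := by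
  have : dAt I (fun _ : M => c) x = 0 := mfderiv_const
  rw [bracket, this]
  rfl

lemma schoutenCommute_zero_right (π : Bivector I M) : π.SchoutenCommute 0 := by
  intro W hW f g h hf hg hh x hx
  simp [jacobiator, bracket_zero_left, bracket_const_right]

lemma isPoisson_zero : (0 : Bivector I M).IsPoisson where
  skew _ ξ := map_zero ξ
  smooth W _ f g _ _ := by
    rw [bracket_zero_left]
    exact contMDiffOn_const
  schouten_self := schoutenCommute_zero_right 0

end Bivector

end Zero

/-! ### Poisson structures on quotients -/

section Descent

variable {EN : Type*} [NormedAddCommGroup EN] [NormedSpace ℝ EN]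
  {HN : Type*} [TopologicalSpace HN] {IN : ModelWithCorners ℝ EN HN}
  {N : Type*} [TopologicalSpace N] [ChartedSpace HN N]
  {EB : Type*} [NormedAddCommGroup EB] [NormedSpace ℝ EB]
  {HB : Type*} [TopologicalSpace HB] {IB : ModelWithCorners ℝ EB HB}
  {B : Type*} [TopologicalSpace B] [ChartedSpace HB B]

lemma mfderiv_congr_fun {f f' : N → B} (h : f = f') (y : N) :
    (mfderiv IN IB f y : EN →L[ℝ] EB) = (mfderiv IN IB f' y : EN →L[ℝ] EB) := by
  subst h
  rfl

lemma dAt_comp {f : N → B} {h : B → ℝ} {y : N} (hh : MDifferentiableAt IB 𝓘(ℝ, ℝ) h (f y))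
    (hf : MDifferentiableAt IN IB f y) :
    dAt IN (h ∘ f) y = covectorPullback IN IB f y (dAt IB h (f y)) :=
  mfderiv_comp y hh hf

variable (IN IB) in
/-- A smooth map `f : N → B` with local smooth sections whose fibres are the orbits of a family
of smooth maps `N → N`. -/
structure IsOrbitMap {Γ : Type*} (φ : Γ → N → N) (f : N → B) : Prop where
  smooth : ContMDiff IN IB ∞ f
  smooth_act : ∀ g, ContMDiff IN IN ∞ (φ g)
  map_act : ∀ g y, f (φ g y) = f y
  transitive : ∀ y z, f y = f z → ∃ g, φ g y = z
  exists_section : ∀ b : B, ∃ U : Set B, IsOpen U ∧ b ∈ U ∧ ∃ s : B → N,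
    ContMDiffOn IB IN ∞ s U ∧ ∀ c ∈ U, f (s c) = c

namespace IsOrbitMap

variable {Γ : Type*} {φ : Γ → N → N} {f : N → B}

lemma surjective (h : IsOrbitMap IN IB φ f) : Function.Surjective f := fun b => by
  obtain ⟨U, -, hb, s, -, hs⟩ := h.exists_section b
  exact ⟨s b, hs b hb⟩

lemma mfderiv_act (h : IsOrbitMap IN IB φ f) (g : Γ) (y : N) (v : EN) :
    (mfderiv IN IB f (φ g y) (mfderiv IN IN (φ g) y v) : EB) = mfderiv IN IB f y v := by
  have h1 : (mfderiv IN IB f y : EN →L[ℝ] EB) = (mfderiv IN IB (f ∘ φ g) y : EN →L[ℝ] EB) :=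
    mfderiv_congr_fun (funext fun y => (h.map_act g y).symm) y
  have h2 := mfderiv_comp y (h.smooth.mdifferentiable (by simp) (φ g y))
    (h.smooth_act g |>.mdifferentiable (by simp) y)
  exact (DFunLike.congr_fun (h1.trans h2) v).symm

lemma submersion (h : IsOrbitMap IN IB φ f) (y : N) : Function.Surjective (mfderiv IN IB f y) := by
  obtain ⟨U, hU, hb, s, hsm, hs⟩ := h.exists_section (f y)
  obtain ⟨g, hg⟩ := h.transitive (s (f y)) y (hs _ hb)
  have h1 : (f ∘ s) =ᶠ[𝓝 (f y)] id := by
    filter_upwards [hU.mem_nhds hb] with c hc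
    exact hs c hc
  have h2 := mfderiv_comp (f y) (h.smooth.mdifferentiable (by simp) (s (f y)))
    ((hsm.contMDiffAt (hU.mem_nhds hb)).mdifferentiableAt (by simp))
  rw [h1.mfderiv_eq, mfderiv_id] at h2
  intro w
  refine ⟨(mfderiv IN IN (φ g) (s (f y)) (mfderiv IB IN s (f y) w) : EN), ?_⟩
  have h3 := h.mfderiv_act g (s (f y)) (mfderiv IB IN s (f y) w)
  rw [hg] at h3
  exact h3.trans (DFunLike.congr_fun h2 w).symm

/-- Functions on the base are smooth if their pullbacks are. -/
lemma contMDiffOn_of_comp (h : IsOrbitMap IN IB φ f) {W : Set B} (hW : IsOpen W) {k : B → ℝ}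
    (hk : ContMDiffOn IN 𝓘(ℝ, ℝ) ∞ (k ∘ f) (f ⁻¹' W)) : ContMDiffOn IB 𝓘(ℝ, ℝ) ∞ k W := by
  intro b hb
  obtain ⟨U, hU, hbU, s, hsm, hs⟩ := h.exists_section b
  have h1 : ContMDiffOn IB 𝓘(ℝ, ℝ) ∞ ((k ∘ f) ∘ s) (U ∩ W) :=
    hk.comp (hsm.mono inter_subset_left) fun c hc => by
      rw [mem_preimage, mem_preimage, hs c hc.1]
      exact hc.2
  have h2 : ContMDiffOn IB 𝓘(ℝ, ℝ) ∞ k (U ∩ W) := h1.congr fun c hc => by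
    rw [Function.comp_apply, Function.comp_apply, hs c hc.1]
  exact (h2.contMDiffAt ((hU.inter hW).mem_nhds ⟨hbU, hb⟩)).contMDiffWithinAt

end IsOrbitMap

namespace Bivector

/-- The pushforward of a bivector at a point, as a map between model spaces. -/
noncomputable def pushAt (f : N → B) (π : Bivector IN N) (y : N) : (EB →L[ℝ] ℝ) →ₗ[ℝ] EB where
  toFun ξ := mfderiv IN IB f y (π y (covectorPullback IN IB f y ξ))
  map_add' ξ η := by
    have : covectorPullback IN IB f y (ξ + η : EB →L[ℝ] ℝ) =
      covectorPullback IN IB f y ξ + covectorPullback IN IB f y η := rfl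
    rw [this, map_add, map_add]
    rfl
  map_smul' c ξ := by
    have : covectorPullback IN IB f y (c • ξ : EB →L[ℝ] ℝ) =
      c • covectorPullback IN IB f y ξ := rfl
    rw [this, map_smul, map_smul]
    rfl

lemma pushAt_apply (f : N → B) (π : Bivector IN N) (y : N) (ξ : EB →L[ℝ] ℝ) :
    pushAt (IB := IB) f π y ξ = mfderiv IN IB f y (π y (covectorPullback IN IB f y ξ)) := rfl

/-- The pushforward of a bivector field under a map `f` with a set-theoretic section `s`. -/
noncomputable def pushforward (f : N → B) (s : B → N) (π : Bivector IN N) : Bivector IB B :=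
  fun b => (pushAt (IB := IB) f π (s b) : (EB →L[ℝ] ℝ) →ₗ[ℝ] EB)

end Bivector

open Bivector

lemma IsOrbitMap.pushAt_act {Γ : Type*} {φ : Γ → N → N} {f : N → B} (h : IsOrbitMap IN IB φ f)
    {π : Bivector IN N} (hπ : ∀ g, IsPoissonMap (φ g) π π) (g : Γ) (y : N) (ξ : EB →L[ℝ] ℝ) :
    pushAt (IB := IB) f π (φ g y) ξ = pushAt (IB := IB) f π y ξ := by
  have h1 : covectorPullback IN IN (φ g) y (covectorPullback IN IB f (φ g y) ξ) =
      covectorPullback IN IB f y ξ := by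
    ext v
    exact congrArg ξ (h.mfderiv_act g y v)
  rw [pushAt_apply, pushAt_apply, ← (hπ g).map_sharp, h1]
  exact h.mfderiv_act g y _

lemma IsOrbitMap.isPoissonMap_pushforward {Γ : Type*} {φ : Γ → N → N} {f : N → B}
    (h : IsOrbitMap IN IB φ f) {π : Bivector IN N} (hπ : ∀ g, IsPoissonMap (φ g) π π) :
    IsPoissonMap f π (pushforward (IB := IB) f (Function.surjInv h.surjective) π) where
  smooth := h.smooth
  map_sharp y ξ := by
    obtain ⟨g, hg⟩ := h.transitive y (Function.surjInv h.surjective (f y))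
      (Function.surjInv_eq h.surjective (f y)).symm
    have h1 := h.pushAt_act hπ g y ξ
    rw [hg] at h1
    exact h1.symm

namespace IsPoissonMap

variable {f : N → B} {π π' : Bivector IN N} {πB πB' : Bivector IB B}

lemma bracket_comp (hf : IsPoissonMap f π πB) {h k : B → ℝ} {y : N}
    (hh : MDifferentiableAt IB 𝓘(ℝ, ℝ) h (f y)) (hk : MDifferentiableAt IB 𝓘(ℝ, ℝ) k (f y)) :
    π.bracket (h ∘ f) (k ∘ f) y = πB.bracket h k (f y) := by
  have hfy := hf.smooth.mdifferentiable (by simp) y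
  unfold bracket
  rw [dAt_comp hh hfy, dAt_comp hk hfy, ← hf.map_sharp]
  rfl

lemma isSkew (hf : IsPoissonMap f π πB) (hs : Function.Surjective f) (hπ : π.IsSkew) :
    πB.IsSkew := fun b ξ => by
  obtain ⟨y, rfl⟩ := hs b
  rw [← hf.map_sharp]
  exact hπ y (covectorPullback IN IB f y ξ)

lemma isSmooth {Γ : Type*} {φ : Γ → N → N} (hf : IsPoissonMap f π πB) (h : IsOrbitMap IN IB φ f)
    (hπ : π.IsSmooth) : πB.IsSmooth := fun W hW k l hk hl => by
  have hd : ∀ {k : B → ℝ}, ContMDiffOn IB 𝓘(ℝ, ℝ) ∞ k W → ∀ {b : B}, b ∈ W →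
      MDifferentiableAt IB 𝓘(ℝ, ℝ) k b := fun hk b hb =>
    (hk.contMDiffAt (hW.mem_nhds hb)).mdifferentiableAt (by simp)
  refine h.contMDiffOn_of_comp hW ?_
  refine (hπ _ (hW.preimage h.smooth.continuous) _ _
    (hk.comp h.smooth.contMDiffOn subset_rfl) (hl.comp h.smooth.contMDiffOn subset_rfl)).congr
    fun y hy => ?_
  exact (hf.bracket_comp (hd hk hy) (hd hl hy)).symm

lemma bracket_bracket_comp (hf : IsPoissonMap f π πB) (hf' : IsPoissonMap f π' πB')
    (hB' : πB'.IsSmooth) {W : Set B} (hW : IsOpen W) {j k l : B → ℝ}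
    (hj : ContMDiffOn IB 𝓘(ℝ, ℝ) ∞ j W) (hk : ContMDiffOn IB 𝓘(ℝ, ℝ) ∞ k W)
    (hl : ContMDiffOn IB 𝓘(ℝ, ℝ) ∞ l W) {y : N} (hy : f y ∈ W) :
    π.bracket (j ∘ f) (π'.bracket (k ∘ f) (l ∘ f)) y =
      πB.bracket j (πB'.bracket k l) (f y) := by
  have hd : ∀ {k : B → ℝ}, ContMDiffOn IB 𝓘(ℝ, ℝ) ∞ k W → ∀ {b : B}, b ∈ W →
      MDifferentiableAt IB 𝓘(ℝ, ℝ) k b := fun hk b hb =>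
    (hk.contMDiffAt (hW.mem_nhds hb)).mdifferentiableAt (by simp)
  have h1 : π'.bracket (k ∘ f) (l ∘ f) =ᶠ[𝓝 y] πB'.bracket k l ∘ f := by
    filter_upwards [(hW.preimage hf.smooth.continuous).mem_nhds hy] with z hz
    exact hf'.bracket_comp (hd hk hz) (hd hl hz)
  have h2 : dAt IN (π'.bracket (k ∘ f) (l ∘ f)) y = dAt IN (πB'.bracket k l ∘ f) y :=
    h1.mfderiv_eq
  rw [← hf.bracket_comp (hd hj hy) (hd (hB' W hW k l hk hl) hy), bracket, bracket, h2]

lemma schoutenCommute (hf : IsPoissonMap f π πB) (hf' : IsPoissonMap f π' πB')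
    (hs : Function.Surjective f) (hB : πB.IsSmooth) (hB' : πB'.IsSmooth)
    (h : π.SchoutenCommute π') : πB.SchoutenCommute πB' := by
  intro W hW j k l hj hk hl b hb
  obtain ⟨y, rfl⟩ := hs b
  have hc : ∀ {k : B → ℝ}, ContMDiffOn IB 𝓘(ℝ, ℝ) ∞ k W →
      ContMDiffOn IN 𝓘(ℝ, ℝ) ∞ (k ∘ f) (f ⁻¹' W) := fun hk =>
    hk.comp hf.smooth.contMDiffOn subset_rfl
  have h1 := h _ (hW.preimage hf.smooth.continuous) _ _ _ (hc hj) (hc hk) (hc hl) y hb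
  unfold jacobiator at h1 ⊢
  rwa [hf.bracket_bracket_comp hf' hB' hW hj hk hl hb,
    hf.bracket_bracket_comp hf' hB' hW hk hl hj hb,
    hf.bracket_bracket_comp hf' hB' hW hl hj hk hb,
    hf'.bracket_bracket_comp hf hB hW hj hk hl hb,
    hf'.bracket_bracket_comp hf hB hW hk hl hj hb,
    hf'.bracket_bracket_comp hf hB hW hl hj hk hb] at h1

lemma isPoisson {Γ : Type*} {φ : Γ → N → N} (hf : IsPoissonMap f π πB)
    (h : IsOrbitMap IN IB φ f) (hπ : π.IsPoisson) : πB.IsPoisson :=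
  ⟨hf.isSkew h.surjective hπ.skew, hf.isSmooth h hπ.smooth,
    hf.schoutenCommute hf h.surjective (hf.isSmooth h hπ.smooth) (hf.isSmooth h hπ.smooth)
      hπ.schouten_self⟩

lemma isPoissonSubmersion {Γ : Type*} {φ : Γ → N → N} (hf : IsPoissonMap f π πB)
    (h : IsOrbitMap IN IB φ f) (hπ : π.IsPoisson) : IsPoissonSubmersion f π πB :=
  ⟨hπ, hf.isPoisson h hπ, h.surjective, h.submersion, hf⟩

end IsPoissonMap

end Descent

/-! ### Coregular Poisson submersions -/

section Coregular

variable {EN : Type*} [NormedAddCommGroup EN] [NormedSpace ℝ EN] [FiniteDimensional ℝ EN]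
  {HN : Type*} [TopologicalSpace HN] {IN : ModelWithCorners ℝ EN HN}
  {N : Type*} [TopologicalSpace N] [ChartedSpace HN N]
  {EB : Type*} [NormedAddCommGroup EB] [NormedSpace ℝ EB] [FiniteDimensional ℝ EB]
  {HB : Type*} [TopologicalSpace HB] {IB : ModelWithCorners ℝ EB HB}
  {B : Type*} [TopologicalSpace B] [ChartedSpace HB B]

lemma contMDiffAt_of_forall_clm {F : N → EB} {x : N}
    (h : ∀ η : EB →L[ℝ] ℝ, ContMDiffAt IN 𝓘(ℝ, ℝ) ∞ (fun y => η (F y)) x) :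
    ContMDiffAt IN 𝓘(ℝ, EB) ∞ F x := by
  let L := (Module.finBasis ℝ EB).equivFunL
  have h1 : ContMDiffAt IN 𝓘(ℝ, Fin (Module.finrank ℝ EB) → ℝ) ∞ (fun y => L (F y)) x :=
    contMDiffAt_pi_space.2 fun i => h ((ContinuousLinearMap.proj i).comp L.toContinuousLinearMap)
  have h2 := L.symm.contDiff.contMDiff.contMDiffAt.comp x h1
  exact h2.congr_of_eventuallyEq (Filter.Eventually.of_forall fun y => (L.symm_apply_apply _).symm)

/-- Hamiltonian vector fields are smooth. -/
lemma contMDiffOn_hamiltonian [IN.Boundaryless] [IsManifold IN ∞ N] {π : Bivector IN N}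
    (hπ : π.IsSmooth) {W : Set N} (hW : IsOpen W) {f : N → ℝ}
    (hf : ContMDiffOn IN 𝓘(ℝ, ℝ) ∞ f W) :
    ContMDiffOn IN IN.tangent ∞ (fun x => (⟨x, π x (dAt IN f x)⟩ : TangentBundle IN N)) W := by
  intro x hx
  refine ContMDiffAt.contMDiffWithinAt ?_
  refine (Bundle.contMDiffAt_section x).2 ?_
  have hs := (isOpen_extChartAt_source (I := IN) x).mem_nhds (mem_extChartAt_source x)
  have h1 : (fun y => (trivializationAt EN (TangentSpace IN) x
      (⟨y, π y (dAt IN f y)⟩ : TangentBundle IN N)).2) =ᶠ[𝓝 x]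
      fun y => (mfderiv IN 𝓘(ℝ, EN) (extChartAt IN x) y (π y (dAt IN f y)) : EN) := by
    filter_upwards [hs] with y hy
    rw [extChartAt_source] at hy
    rw [← TangentBundle.continuousLinearMapAt_trivializationAt hy]
    exact ((trivializationAt EN (TangentSpace IN) x).continuousLinearMapAt_apply_of_mem (R := ℝ)
      (by simpa using hy) _).symm
  refine ContMDiffAt.congr_of_eventuallyEq ?_ h1
  refine contMDiffAt_of_forall_clm fun η => ?_
  have h2 : ContMDiffOn IN 𝓘(ℝ, ℝ) ∞ (η ∘ extChartAt IN x) (extChartAt IN x).source :=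
    fun y hy => (η.contDiff.contMDiff.contMDiffAt.comp y
      (contMDiffAt_extChartAt_of_mem hy)).contMDiffWithinAt
  have h3 := hπ _ (hW.inter (isOpen_extChartAt_source (I := IN) x)) f _ (hf.mono inter_subset_left)
    (h2.mono inter_subset_right)
  refine (h3.contMDiffAt (Filter.inter_mem (hW.mem_nhds hx) hs)).congr_of_eventuallyEq ?_
  filter_upwards [hs] with y hy
  have h4 := dAt_comp_extChartAt hy η.differentiableAt
  rw [η.fderiv] at h4
  rw [Bivector.bracket, h4]
  rfl

lemma covectorPullback_mem_annihilatorAt (f : N → B) (y : N) (ξ : CotangentSpace IB (f y)) :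
    covectorPullback IN IB f y ξ ∈ annihilatorAt (verticalSpace IN IB f y) := fun v hv =>
  (congrArg ξ (show mfderiv IN IB f y v = 0 from hv)).trans (map_zero ξ)

lemma exists_covectorPullback_eq {f : N → B} {y : N} (hf : Function.Surjective (mfderiv IN IB f y))
    {ζ : CotangentSpace IN y} (hζ : ζ ∈ annihilatorAt (verticalSpace IN IB f y)) :
    ∃ ξ : CotangentSpace IB (f y), ζ = covectorPullback IN IB f y ξ :=
  exists_clm_comp_eq (E := EN) (E' := EB) (mfderiv IN IB f y) hf ζ fun v hv => hζ v hv

variable [IN.Boundaryless] [IsManifold IN ∞ N] [IB.Boundaryless] [IsManifold IB ∞ B]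

/-- Every covector is the differential of a locally defined smooth function. -/
lemma exists_contMDiffOn_dAt_eq (m : B) (ξ : EB →L[ℝ] ℝ) : ∃ k : B → ℝ,
    ContMDiffOn IB 𝓘(ℝ, ℝ) ∞ k (extChartAt IB m).source ∧ dAt IB k m = ξ := by
  have hm := mem_extChartAt_source (I := IB) m
  refine ⟨ξ ∘ extChartAt IB m, fun y hy => (ξ.contDiff.contMDiff.contMDiffAt.comp y
    (contMDiffAt_extChartAt_of_mem hy)).contMDiffWithinAt, ?_⟩
  have h := dAt_comp_extChartAt hm ξ.differentiableAt
  rw [ξ.fderiv] at h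
  refine h.trans ?_
  ext v
  exact congrArg ξ (DFunLike.congr_fun (mfderiv_extChartAt_self (I := IB) (x := m)) v)

/-- For a Poisson submersion, the subbundle condition in the definition of coregularity follows
from the trivial intersection condition. -/
lemma IsPoissonSubmersion.isCoregularSubmersion {f : N → B} {π : Bivector IN N}
    {πB : Bivector IB B} (hf : IsPoissonSubmersion f π πB)
    (h : ∀ y, (annihilatorAt (verticalSpace IN IB f y)).map (π y) ⊓ verticalSpace IN IB f y = ⊥) :
    IsCoregularSubmersion f π πB := by
  refine ⟨hf, fun m => ⟨fun y₀ hy₀ => ?_, fun y _ => h y⟩⟩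
  have : FiniteDimensional ℝ (TangentSpace IB m) := inferInstanceAs (FiniteDimensional ℝ EB)
  let b := Module.finBasis ℝ (LinearMap.range (πB m))
  choose η hη using fun i => (b i).2
  have hWo : IsOpen (f ⁻¹' (extChartAt IB m).source) :=
    (isOpen_extChartAt_source m).preimage hf.isPoissonMap.smooth.continuous
  have hm := mem_extChartAt_source (I := IB) m
  choose k hsm hk using fun i => exists_contMDiffOn_dAt_eq (IB := IB) m (η i : EB →L[ℝ] ℝ)
  refine ⟨_, hWo, by rw [mem_preimage, show f y₀ = m from hy₀]; exact hm, _,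
    fun i x => π x (dAt IN (k i ∘ f) x), fun i => ?_, ?_⟩
  · exact contMDiffOn_hamiltonian hf.isPoisson_source.smooth hWo
      ((hsm i).comp hf.isPoissonMap.smooth.contMDiffOn subset_rfl)
  rintro x ⟨hx, -⟩
  have hx : f x = m := hx
  subst hx
  have hd : ∀ i, dAt IN (k i ∘ f) x =
      covectorPullback IN IB f x (η i) := fun i => by
    rw [dAt_comp (((hsm i).contMDiffAt ((isOpen_extChartAt_source (f x)).mem_nhds
      hm)).mdifferentiableAt (by simp)) (hf.isPoissonMap.smooth.mdifferentiable (by simp) x),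
      hk]
  have hpush : ∀ i, mfderiv IN IB f x (π x (covectorPullback IN IB f x (η i))) = b i := fun i =>
    (hf.isPoissonMap.map_sharp x (η i)).trans (hη i)
  simp only [hd]
  constructor
  · refine LinearIndependent.of_comp (mfderiv IN IB f x).toLinearMap ?_
    have h1 : ((mfderiv IN IB f x).toLinearMap ∘
        fun i => π x (covectorPullback IN IB f x (η i))) = fun i => (b i : TangentSpace IB (f x)) :=
      funext hpush
    rw [h1]
    exact b.linearIndependent.map' (Submodule.subtype _) (Submodule.ker_subtype _)
  · refine le_antisymm (Submodule.span_le.2 ?_) ?_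
    · rintro _ ⟨i, rfl⟩
      exact Submodule.mem_map_of_mem (covectorPullback_mem_annihilatorAt f x _)
    · rintro _ ⟨ζ, hζ, rfl⟩
      obtain ⟨ξ, rfl⟩ := exists_covectorPullback_eq (hf.submersion x) hζ
      let c := b.repr ⟨πB (f x) ξ, ξ, rfl⟩
      have hc : ∑ i, c i • (b i : TangentSpace IB (f x)) = πB (f x) ξ := by
        have h1 := congrArg (Submodule.subtype _) (b.sum_repr ⟨πB (f x) ξ, ξ, rfl⟩)
        rw [map_sum] at h1
        exact h1
      have h2 : π x (covectorPullback IN IB f x ξ) =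
          ∑ i, c i • π x (covectorPullback IN IB f x (η i)) := by
        rw [← sub_eq_zero, ← Submodule.mem_bot ℝ, ← h x]
        refine ⟨Submodule.sub_mem _ (Submodule.mem_map_of_mem hζ) (Submodule.sum_mem _ fun i _ =>
          Submodule.smul_mem _ _ (Submodule.mem_map_of_mem
            (covectorPullback_mem_annihilatorAt f x _))), ?_⟩
        change mfderiv IN IB f x _ = 0
        rw [map_sub, map_sum, hf.isPoissonMap.map_sharp, ← hc, sub_eq_zero]
        refine Finset.sum_congr rfl fun i _ => ?_
        rw [map_smul, hpush]
      rw [h2]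
      exact Submodule.sum_mem _ fun i _ => Submodule.smul_mem _ _ (Submodule.subset_span ⟨i, rfl⟩)

end Coregular

/-! ### Poisson maps and products -/

section ProdMaps

variable {E : Type*} [NormedAddCommGroup E] [NormedSpace ℝ E]
  {H : Type*} [TopologicalSpace H] {I : ModelWithCorners ℝ E H}
  {M : Type*} [TopologicalSpace M] [ChartedSpace H M]
  {E' : Type*} [NormedAddCommGroup E'] [NormedSpace ℝ E']
  {H' : Type*} [TopologicalSpace H'] {I' : ModelWithCorners ℝ E' H'}
  {M' : Type*} [TopologicalSpace M'] [ChartedSpace H' M']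
  {F : Type*} [NormedAddCommGroup F] [NormedSpace ℝ F]
  {K : Type*} [TopologicalSpace K] {J : ModelWithCorners ℝ F K}
  {N : Type*} [TopologicalSpace N] [ChartedSpace K N]
  {F' : Type*} [NormedAddCommGroup F'] [NormedSpace ℝ F']
  {K' : Type*} [TopologicalSpace K'] {J' : ModelWithCorners ℝ F' K'}
  {N' : Type*} [TopologicalSpace N'] [ChartedSpace K' N']

lemma IsPoissonMap.prodMap {f : M → N} {f' : M' → N'} {π : Bivector I M} {π' : Bivector I' M'}
    {ρ : Bivector J N} {ρ' : Bivector J' N'} (hf : IsPoissonMap f π ρ)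
    (hf' : IsPoissonMap f' π' ρ') : IsPoissonMap (Prod.map f f') (π.prod π') (ρ.prod ρ') where
  smooth := hf.smooth.prodMap hf'.smooth
  map_sharp z ξ := by
    have h1 := prodMap_pushforward (E := E) (E' := E') (F := F) (F' := F')
      (mfderiv_prodMap (hf.smooth.mdifferentiable (by simp) z.1)
        (hf'.smooth.mdifferentiable (by simp) z.2)) (π z.1) (π' z.2) ξ
    exact h1.trans (Prod.ext (hf.map_sharp z.1 (Bivector.restrictFst (f z.1, f' z.2) ξ))
      (hf'.map_sharp z.2 (Bivector.restrictSnd (f z.1, f' z.2) ξ)))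

lemma isPoissonMap_fst (π : Bivector I M) (π' : Bivector I' M') :
    IsPoissonMap (Prod.fst : M × M' → M) (π.prod π') π where
  smooth := contMDiff_fst
  map_sharp z ξ := by
    have h1 : covectorPullback (I.prod I') I Prod.fst z ξ =
        (ξ : E →L[ℝ] ℝ).comp (ContinuousLinearMap.fst ℝ E E') :=
      congrArg (fun T : E × E' →L[ℝ] E => (ξ : E →L[ℝ] ℝ).comp T) mfderiv_fst
    rw [h1]
    exact DFunLike.congr_fun (mfderiv_fst (I := I) (I' := I') (x := z)) _

end ProdMaps

section Splitting

variable {EN : Type*} [NormedAddCommGroup EN] [NormedSpace ℝ EN] [FiniteDimensional ℝ EN]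
  {HN : Type*} [TopologicalSpace HN] {IN : ModelWithCorners ℝ EN HN}
  {N : Type*} [TopologicalSpace N] [ChartedSpace HN N]
  {EB : Type*} [NormedAddCommGroup EB] [NormedSpace ℝ EB]
  {HB : Type*} [TopologicalSpace HB] {IB : ModelWithCorners ℝ EB HB}
  {B : Type*} [TopologicalSpace B] [ChartedSpace HB B]

/-- The symmetries of the quotient map preserve the parts of an orthogonal splitting. -/
lemma IsOrbitMap.isPoissonMap_splitting {Γ : Type*} {φ : Γ → N → N} {f : N → B}
    (h : IsOrbitMap IN IB φ f) {π πV πH : Bivector IN N} (hπ : ∀ g, IsPoissonMap (φ g) π π)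
    (hV : πV.IsSkew) (hH : πH.IsSkew) (hadd : ∀ y, π y = πV y + πH y)
    (hVV : ∀ y, LinearMap.range (πV y) ≤ verticalSpace IN IB f y)
    (hHV : ∀ y, LinearMap.range (πH y) ⊓ verticalSpace IN IB f y = ⊥) (g : Γ) :
    IsPoissonMap (φ g) πV πV ∧ IsPoissonMap (φ g) πH πH := by
  have hmap : ∀ (y : N) (ξ : EN →L[ℝ] ℝ), Bivector.pushAt (IB := IN) (φ g) πV y ξ +
      Bivector.pushAt (IB := IN) (φ g) πH y ξ = (πV (φ g y) ξ + πH (φ g y) ξ : EN) := by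
    intro y ξ
    have h1 := (hπ g).map_sharp y ξ
    rw [hadd, hadd] at h1
    rw [Bivector.pushAt_apply, Bivector.pushAt_apply]
    exact (map_add (mfderiv IN IN (φ g) y) _ _).symm.trans h1
  have key : ∀ y, Bivector.pushAt (IB := IN) (φ g) πH y = πH (φ g y) := by
    intro y
    refine skew_splitting_unique (E := EN) (V := verticalSpace IN IB f (φ g y))
      (A := Bivector.pushAt (IB := IN) (φ g) πV y) (A' := πV (φ g y))
      (fun ξ => hV y (covectorPullback IN IN (φ g) y ξ)) (hV (φ g y))
      (fun ξ => hH y (covectorPullback IN IN (φ g) y ξ)) (hH (φ g y)) ?_ (hVV _) ?_ (hHV _)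
      (LinearMap.ext (hmap y))
    · rintro _ ⟨ξ, rfl⟩
      exact (h.mfderiv_act g y _).trans (hVV y ⟨covectorPullback IN IN (φ g) y ξ, rfl⟩)
    · rw [eq_bot_iff]
      rintro _ ⟨⟨ξ, rfl⟩, hv⟩
      have h1 : πH y (covectorPullback IN IN (φ g) y ξ) ∈
          LinearMap.range (πH y) ⊓ verticalSpace IN IB f y :=
        ⟨⟨_, rfl⟩, (h.mfderiv_act g y _).symm.trans hv⟩
      rw [hHV, Submodule.mem_bot] at h1
      exact (congrArg (mfderiv IN IN (φ g) y) h1).trans (map_zero _)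
  refine ⟨⟨h.smooth_act g, fun y ξ => ?_⟩, ⟨h.smooth_act g, fun y ξ => ?_⟩⟩
  · have h1 := hmap y ξ
    rw [key] at h1
    exact add_right_cancel (G := EN) h1
  · exact DFunLike.congr_fun (key y) ξ

end Splitting

/-! ### Quotient maps of principal and associated bundles -/

section BundleMaps

variable {EG : Type*} [NormedAddCommGroup EG] [NormedSpace ℝ EG]
  {HG : Type*} [TopologicalSpace HG] {IG : ModelWithCorners ℝ EG HG}
  {EP : Type*} [NormedAddCommGroup EP] [NormedSpace ℝ EP]
  {HP : Type*} [TopologicalSpace HP] {IP : ModelWithCorners ℝ EP HP}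
  {EM : Type*} [NormedAddCommGroup EM] [NormedSpace ℝ EM]
  {HM : Type*} [TopologicalSpace HM] {IM : ModelWithCorners ℝ EM HM}
  {EX : Type*} [NormedAddCommGroup EX] [NormedSpace ℝ EX]
  {HX : Type*} [TopologicalSpace HX] {IX : ModelWithCorners ℝ EX HX}
  {G : Type*} [Group G] [TopologicalSpace G] [ChartedSpace HG G]
  {P : Type*} [TopologicalSpace P] [ChartedSpace HP P] [MulAction Gᵐᵒᵖ P]
  {M : Type*} [TopologicalSpace M] [ChartedSpace HM M]
  {X : Type*} [TopologicalSpace X] [ChartedSpace HX X] [MulAction G X]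
  {p : P → M}

namespace IsPrincipalBundle

lemma contMDiff (hp : IsPrincipalBundle IG IP IM (G := G) p) : ContMDiff IP IM ∞ p := fun y => by
  obtain ⟨e, hm, he⟩ := hp.exists_trivialization (p y)
  have hy : y ∈ e.source := e.mem_source.2 hm
  have h1 : ContMDiffOn IP IM ∞ (fun y => (e y).1) e.source :=
    contMDiff_fst.comp_contMDiffOn he.contMDiffOn_toFun
  exact (h1.congr fun z hz => (e.coe_fst hz).symm).contMDiffAt (e.open_source.mem_nhds hy)

lemma contMDiff_smul (hp : IsPrincipalBundle IG IP IM (G := G) p) (g : G) :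
    ContMDiff IP IP ∞ fun y : P => MulOpposite.op g • y :=
  hp.contMDiff_action.comp (contMDiff_id.prodMk contMDiff_const)

lemma isOrbitMap (hp : IsPrincipalBundle IG IP IM (G := G) p) :
    IsOrbitMap IP IM (fun (g : G) (y : P) => MulOpposite.op g • y) p where
  smooth := hp.contMDiff
  smooth_act := hp.contMDiff_smul
  map_act g y := hp.map_smul y g
  transitive y z hyz := by
    obtain ⟨e, hm, he⟩ := hp.exists_trivialization (p y)
    have hy : y ∈ e.source := e.mem_source.2 hm
    have hz : z ∈ e.source := e.mem_source.2 (hyz ▸ hm)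
    have hg : MulOpposite.op ((e y).2⁻¹ * (e z).2) • y ∈ e.source := by
      rw [e.mem_source, hp.map_smul]
      exact hm
    refine ⟨(e y).2⁻¹ * (e z).2, e.injOn hg hz (show e _ = e _ from Prod.ext ?_ ?_)⟩
    · rw [e.coe_fst hg, e.coe_fst hz, hp.map_smul, hyz]
    · rw [he.map_smul y hy, mul_inv_cancel_left]
  exists_section m := by
    obtain ⟨e, hm, he⟩ := hp.exists_trivialization m
    refine ⟨e.baseSet, e.open_baseSet, hm,
      fun u => e.toOpenPartialHomeomorph.symm (u, (1 : G)), ?_, fun u hu => e.proj_symm_apply' hu⟩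
    exact he.contMDiffOn_symm.comp (contMDiffOn_id.prodMk contMDiffOn_const)
      fun u hu => e.mem_target.2 hu

end IsPrincipalBundle

namespace AssociatedBundle

variable (hp : IsPrincipalBundle IG IP IM (G := G) p) [ContMDiffSMul IG IX ∞ G X]

lemma mk_surjective : Function.Surjective (mk IX X hp) := Quotient.mk_surjective

lemma trivChart_trans_mem_atlas {e : Bundle.Trivialization G p}
    (he : IsPrincipalTrivialization IG IP IM e) (w : M × X) :
    (trivChart (IX := IX) (X := X) hp he).trans (chartAt (ModelProd HM HX) w) ∈
      atlas (ModelProd HM HX) (AssociatedBundle hp IX X) :=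
  ⟨_, ⟨e, he, rfl⟩, _, chart_mem_atlas _ w, rfl⟩

lemma trivChart_mk {e : Bundle.Trivialization G p} (he : IsPrincipalTrivialization IG IP IM e)
    {y : P} (hy : p y ∈ e.baseSet) (x : X) :
    trivChart (IX := IX) (X := X) hp he (mk IX X hp (y, x)) = (p y, (e y).2 • x) :=
  chartFun_mk hp he hy x

variable [IsManifold IM ∞ M] [IsManifold IX ∞ X]

lemma contMDiffOn_trivChart {e : Bundle.Trivialization G p}
    (he : IsPrincipalTrivialization IG IP IM e) :
    ContMDiffOn (IM.prod IX) (IM.prod IX) ∞ (trivChart (IX := IX) (X := X) hp he)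
      (trivChart (IX := IX) (X := X) hp he).source := by
  intro z hz
  set φ := trivChart (IX := IX) (X := X) hp he
  set c := chartAt (ModelProd HM HX) (φ z)
  have hC := IsManifold.subset_maximalAtlas (I := IM.prod IX) (n := ∞)
    (trivChart_trans_mem_atlas (IX := IX) hp he (φ z))
  have hz' : z ∈ (φ.trans c).source := by
    rw [OpenPartialHomeomorph.trans_source]
    exact ⟨hz, mem_chart_source (ModelProd HM HX) (φ z)⟩
  have h1 : ContMDiffAt (IM.prod IX) (IM.prod IX) ∞ (φ.trans c) z :=
    contMDiffAt_of_mem_maximalAtlas hC hz'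
  have h2 : ContMDiffAt (IM.prod IX) (IM.prod IX) ∞ c.symm (φ.trans c z) :=
    contMDiffAt_symm_of_mem_maximalAtlas (IsManifold.chart_mem_maximalAtlas (φ z))
      (c.map_source (mem_chart_source (ModelProd HM HX) (φ z)))
  refine ((h2.comp z h1).congr_of_eventuallyEq ?_).contMDiffWithinAt
  filter_upwards [(φ.trans c).open_source.mem_nhds hz'] with y hy
  rw [OpenPartialHomeomorph.trans_source] at hy
  exact (c.left_inv hy.2).symm

lemma contMDiffOn_trivChart_symm {e : Bundle.Trivialization G p}
    (he : IsPrincipalTrivialization IG IP IM e) :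
    ContMDiffOn (IM.prod IX) (IM.prod IX) ∞ (trivChart (IX := IX) (X := X) hp he).symm
      (trivChart (IX := IX) (X := X) hp he).target := by
  intro w hw
  set φ := trivChart (IX := IX) (X := X) hp he
  set c := chartAt (ModelProd HM HX) w
  have hC := IsManifold.subset_maximalAtlas (I := IM.prod IX) (n := ∞)
    (trivChart_trans_mem_atlas (IX := IX) hp he w)
  have hwc := mem_chart_source (ModelProd HM HX) w
  have h1 : ContMDiffAt (IM.prod IX) (IM.prod IX) ∞ c w :=
    contMDiffAt_of_mem_maximalAtlas (IsManifold.chart_mem_maximalAtlas w) hwc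
  have h2 : ContMDiffAt (IM.prod IX) (IM.prod IX) ∞ (φ.trans c).symm (c w) := by
    refine contMDiffAt_symm_of_mem_maximalAtlas hC ?_
    rw [OpenPartialHomeomorph.trans_target]
    refine ⟨c.map_source hwc, ?_⟩
    rw [mem_preimage, c.left_inv hwc]
    exact hw
  refine ((h2.comp w h1).congr_of_eventuallyEq ?_).contMDiffWithinAt
  filter_upwards [c.open_source.mem_nhds hwc] with y hy
  exact congrArg φ.symm (c.left_inv hy).symm

lemma contMDiff_mk : ContMDiff (IP.prod IX) (IM.prod IX) ∞ (mk IX X hp) := by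
  rintro ⟨y, x⟩
  obtain ⟨e, hm, he⟩ := hp.exists_trivialization (p y)
  set φ := trivChart (IX := IX) (X := X) hp he
  have hfst : ContMDiffOn (IP.prod IX) IP ∞ (Prod.fst : P × X → P) (e.source ×ˢ univ) :=
    contMDiffOn_fst
  have h1 := he.contMDiffOn_toFun.comp hfst fun z hz => hz.1
  have h2 : ContMDiffOn (IP.prod IX) (IM.prod IX) ∞ (fun z : P × X => (p z.1, (e z.1).2 • z.2))
      (e.source ×ˢ univ) :=
    (hp.contMDiff.comp_contMDiffOn hfst).prodMk
      ((contMDiff_snd.comp_contMDiffOn h1).smul (I := IG) (I' := IX) contMDiffOn_snd)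
  have h3 := (contMDiffOn_trivChart_symm (IX := IX) (X := X) hp he).comp h2
    fun z hz => ⟨e.mem_source.1 hz.1, mem_univ _⟩
  refine (h3.congr ?_).contMDiffAt ((e.open_source.prod isOpen_univ).mem_nhds
    ⟨e.mem_source.2 hm, mem_univ _⟩)
  rintro ⟨y', x'⟩ ⟨hy', -⟩
  have hb : p y' ∈ e.baseSet := e.mem_source.1 hy'
  have h4 : mk IX X hp (y', x') ∈ φ.source := hb
  rw [Function.comp_apply, ← trivChart_mk (IX := IX) hp he hb]
  exact (φ.left_inv h4).symm

lemma contMDiff_proj : ContMDiff (IM.prod IX) IM ∞ (proj IX X hp) := by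
  intro z
  obtain ⟨e, hm, he⟩ := hp.exists_trivialization (proj IX X hp z)
  have hz : z ∈ (trivChart (IX := IX) (X := X) hp he).source := hm
  refine ((contMDiff_fst.comp_contMDiffOn (contMDiffOn_trivChart hp he)).congr ?_).contMDiffAt
    ((trivChart (IX := IX) (X := X) hp he).open_source.mem_nhds hz)
  rintro ⟨y, x⟩ hy
  exact (congrArg Prod.fst (trivChart_mk (IX := IX) hp he (show p y ∈ e.baseSet from hy) x)).symm

lemma isOrbitMap_mk : IsOrbitMap (IP.prod IX) (IM.prod IX)
    (fun g : G => Prod.map (fun y : P => MulOpposite.op g⁻¹ • y) (fun x : X => g • x))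
    (mk IX X hp) where
  smooth := contMDiff_mk hp
  smooth_act g := (hp.contMDiff_smul g⁻¹).prodMap
    ((contMDiff_const (c := g)).smul (I := IG) (I' := IX) contMDiff_id)
  map_act g z := mk_smul hp g z.1 z.2
  transitive y z hyz := by
    obtain ⟨g, hg⟩ := Quotient.exact (s := associatedSetoid G P X) hyz
    exact ⟨g, hg.symm⟩
  exists_section z := by
    obtain ⟨e, hm, he⟩ := hp.exists_trivialization (proj IX X hp z)
    set φ := trivChart (IX := IX) (X := X) hp he
    refine ⟨φ.source, φ.open_source, hm,
      fun z => (e.toOpenPartialHomeomorph.symm ((φ z).1, (1 : G)), (φ z).2), ?_,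
      fun c hc => φ.left_inv hc⟩
    have h1 := contMDiffOn_trivChart (IX := IX) (X := X) hp he
    have h2 : ContMDiffOn (IM.prod IX) IM ∞ (fun z => (φ z).1) φ.source :=
      contMDiff_fst.comp_contMDiffOn h1
    refine ContMDiffOn.prodMk ?_ (contMDiff_snd.comp_contMDiffOn h1)
    exact he.contMDiffOn_symm.comp (h2.prodMk contMDiffOn_const)
      fun z hz => e.mem_target.2 (φ.map_source hz).1

lemma mfderiv_proj_mfderiv_mk (z : P × X) (v : EP × EX) :
    (mfderiv (IM.prod IX) IM (proj IX X hp) (mk IX X hp z)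
      (mfderiv (IP.prod IX) (IM.prod IX) (mk IX X hp) z v) : EM) = mfderiv IP IM p z.1 v.1 := by
  have h1 := mfderiv_comp z ((contMDiff_proj (IX := IX) (X := X) hp).mdifferentiable (by simp)
    (mk IX X hp z)) ((contMDiff_mk (IX := IX) (X := X) hp).mdifferentiable (by simp) z)
  have h2 : mfderiv (IP.prod IX) IM (p ∘ Prod.fst) z = _ :=
    mfderiv_comp (I := IP.prod IX) z (hp.contMDiff.mdifferentiable (by simp) z.1)
      (mdifferentiableAt_fst (M' := X))
  rw [mfderiv_fst] at h2
  exact (DFunLike.congr_fun (h1.symm.trans h2) v)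

end AssociatedBundle

end BundleMaps

section AssociatedPoisson

variable {EG : Type*} [NormedAddCommGroup EG] [NormedSpace ℝ EG]
  {HG : Type*} [TopologicalSpace HG] {IG : ModelWithCorners ℝ EG HG}
  {EP : Type*} [NormedAddCommGroup EP] [NormedSpace ℝ EP] [FiniteDimensional ℝ EP]
  {HP : Type*} [TopologicalSpace HP] {IP : ModelWithCorners ℝ EP HP} [IP.Boundaryless]
  {EM : Type*} [NormedAddCommGroup EM] [NormedSpace ℝ EM] [FiniteDimensional ℝ EM]
  {HM : Type*} [TopologicalSpace HM] {IM : ModelWithCorners ℝ EM HM} [IM.Boundaryless]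
  {EX : Type*} [NormedAddCommGroup EX] [NormedSpace ℝ EX] [FiniteDimensional ℝ EX]
  {HX : Type*} [TopologicalSpace HX] {IX : ModelWithCorners ℝ EX HX} [IX.Boundaryless]
  {G : Type*} [Group G] [TopologicalSpace G] [ChartedSpace HG G]
  {P : Type*} [TopologicalSpace P] [ChartedSpace HP P] [MulAction Gᵐᵒᵖ P] [IsManifold IP ∞ P]
  {M : Type*} [TopologicalSpace M] [ChartedSpace HM M] [IsManifold IM ∞ M]
  {X : Type*} [TopologicalSpace X] [ChartedSpace HX X] [MulAction G X] [IsManifold IX ∞ X]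
  {p : P → M} {hp : IsPrincipalBundle IG IP IM (G := G) p} [ContMDiffSMul IG IX ∞ G X]
  {πP : Bivector IP P} {πX : Bivector IX X} {πM : Bivector IM M}
  {πS : Bivector (IM.prod IX) (AssociatedBundle hp IX X)}

open Bivector AssociatedBundle

/-- The projection of the associated bundle maps the pushforward of `π × π'` to that of `π`. -/
lemma mfderiv_proj_apply {π : Bivector IP P} {π' : Bivector IX X}
    {ρ : Bivector (IM.prod IX) (AssociatedBundle hp IX X)}
    (hρ : IsPoissonMap (mk IX X hp) (π.prod π') ρ) (z : P × X)
    (ξ : CotangentSpace (IM.prod IX) (mk IX X hp z)) :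
    (mfderiv (IM.prod IX) IM (proj IX X hp) (mk IX X hp z) (ρ (mk IX X hp z) ξ) : EM) =
      mfderiv IP IM p z.1 (π z.1
        (restrictFst z (covectorPullback (IP.prod IX) (IM.prod IX) (mk IX X hp) z ξ))) := by
  rw [← hρ.map_sharp]
  exact mfderiv_proj_mfderiv_mk hp z _

/-- The double pullback of a covector on `M` to `P × X`, restricted to `P`. -/
lemma restrictFst_covectorPullback_proj (z : P × X) (ξ : CotangentSpace IM (p z.1)) :
    restrictFst z (covectorPullback (IP.prod IX) (IM.prod IX) (mk IX X hp) z
      (covectorPullback (IM.prod IX) IM (proj IX X hp) (mk IX X hp z) ξ)) =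
        covectorPullback IP IM p z.1 ξ := by
  ext v
  exact congrArg ξ (mfderiv_proj_mfderiv_mk hp z ((v : EP), (0 : EX)))

lemma restrictSnd_covectorPullback_proj (z : P × X) (ξ : CotangentSpace IM (p z.1)) :
    restrictSnd z (covectorPullback (IP.prod IX) (IM.prod IX) (mk IX X hp) z
      (covectorPullback (IM.prod IX) IM (proj IX X hp) (mk IX X hp z) ξ)) = 0 := by
  ext w
  exact (congrArg ξ ((mfderiv_proj_mfderiv_mk (EP := EP) (EX := EX) hp z (0, w)).trans
    (map_zero (mfderiv IP IM p z.1)))).trans (map_zero ξ)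

lemma isPoissonSubmersion_proj [Nonempty X] (hπP : IsPoissonSubmersion p πP πM)
    (hS : IsPoissonSubmersion (mk IX X hp) (πP.prod πX) πS) :
    IsPoissonSubmersion (proj IX X hp) πS πM where
  isPoisson_source := hS.isPoisson_target
  isPoisson_target := hπP.isPoisson_target
  surjective m := by
    obtain ⟨y, rfl⟩ := hπP.surjective m
    exact ⟨mk IX X hp (y, Classical.arbitrary X), rfl⟩
  submersion z := by
    obtain ⟨z, rfl⟩ := mk_surjective (IX := IX) (X := X) hp z
    intro w
    obtain ⟨v, hv⟩ := hπP.submersion z.1 w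
    exact ⟨mfderiv (IP.prod IX) (IM.prod IX) (mk IX X hp) z ((v : EP), (0 : EX)),
      (mfderiv_proj_mfderiv_mk hp z ((v : EP), (0 : EX))).trans hv⟩
  isPoissonMap :=
    { smooth := contMDiff_proj hp
      map_sharp := fun z ξ => by
        obtain ⟨z, rfl⟩ := mk_surjective (IX := IX) (X := X) hp z
        refine (mfderiv_proj_apply hS.isPoissonMap z _).trans ?_
        refine Eq.trans ?_ (hπP.isPoissonMap.map_sharp z.1 ξ)
        exact congrArg (fun ζ => mfderiv IP IM p z.1 (πP z.1 ζ))
          (restrictFst_covectorPullback_proj z ξ) }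

lemma isCoregularSubmersion_proj [Nonempty X] (hπP : IsCoregularSubmersion p πP πM)
    (hS : IsPoissonSubmersion (mk IX X hp) (πP.prod πX) πS) :
    IsCoregularSubmersion (proj IX X hp) πS πM := by
  have hproj := isPoissonSubmersion_proj hπP.isPoissonSubmersion hS
  refine hproj.isCoregularSubmersion fun z => ?_
  obtain ⟨z, rfl⟩ := mk_surjective (IX := IX) (X := X) hp z
  rw [eq_bot_iff]
  rintro _ ⟨⟨ζ, hζ, rfl⟩, hv⟩
  obtain ⟨ξ, rfl⟩ := exists_covectorPullback_eq (hproj.submersion _) hζ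
  have h1 : πP z.1 (covectorPullback IP IM p z.1 ξ) ∈
      (annihilatorAt (verticalSpace IP IM p z.1)).map (πP z.1) ⊓ verticalSpace IP IM p z.1 := by
    refine ⟨Submodule.mem_map_of_mem (covectorPullback_mem_annihilatorAt p z.1 _), ?_⟩
    refine (congrArg (fun ζ => mfderiv IP IM p z.1 (πP z.1 ζ))
      (restrictFst_covectorPullback_proj (hp := hp) (IX := IX) z ξ)).symm.trans ?_
    exact (mfderiv_proj_apply hS.isPoissonMap z _).symm.trans hv
  rw [(hπP.coregular_fibres (p z.1)).trivial_inter z.1 rfl, Submodule.mem_bot] at h1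
  have h2 : πP.prod πX z (covectorPullback (IP.prod IX) (IM.prod IX) (mk IX X hp) z
      (covectorPullback (IM.prod IX) IM (proj IX X hp) (mk IX X hp z) ξ)) = 0 := by
    exact Prod.ext ((congrArg (πP z.1) (restrictFst_covectorPullback_proj z ξ)).trans h1)
      ((congrArg (πX z.2) (restrictSnd_covectorPullback_proj z ξ)).trans (map_zero (πX z.2)))
  rw [Submodule.mem_bot, ← hS.isPoissonMap.map_sharp, h2, map_zero]

lemma isOrthogonalPencil_proj [Nonempty X] (hinv : ∀ g : G,
      IsPoissonMap (fun y : P => MulOpposite.op g • y) πP πP)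
    (hπX : πX.IsPoisson) (hact : ∀ g : G, IsPoissonMap (fun x : X => g • x) πX πX)
    (hπP : IsOrthogonalPencil p πP πM)
    (hS : IsPoissonSubmersion (mk IX X hp) (πP.prod πX) πS) :
    IsOrthogonalPencil (proj IX X hp) πS πM := by
  refine ⟨isPoissonSubmersion_proj hπP.isPoissonSubmersion hS, ?_⟩
  obtain ⟨πV, πH, hV, hH, hVH, hadd, hVV, hHV⟩ := hπP.exists_splitting
  have hsplit := hp.isOrbitMap.isPoissonMap_splitting hinv hV.skew hH.skew hadd hVV hHV
  have hzero : ∀ g : G, IsPoissonMap (fun x : X => g • x) (0 : Bivector IX X) 0 := fun g =>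
    ⟨(hact g).smooth, fun x ξ => map_zero (mfderiv IX IX (fun x : X => g • x) x)⟩
  have hq := isOrbitMap_mk (IX := IX) (X := X) hp
  have hV' := hq.isPoissonMap_pushforward fun g => (hsplit g⁻¹).1.prodMap (hact g)
  have hH' := hq.isPoissonMap_pushforward fun g => (hsplit g⁻¹).2.prodMap (hzero g)
  have hVp := hV'.isPoisson hq (hV.prod hπX)
  have hHp := hH'.isPoisson hq (hH.prod isPoisson_zero)
  refine ⟨_, _, hVp, hHp, ?_, fun z => ?_, fun z => ?_, fun z => ?_⟩
  · exact hV'.schoutenCommute hH' hq.surjective hVp.smooth hHp.smooth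
      (SchoutenCommute.prod hV hH hπX isPoisson_zero hVH (schoutenCommute_zero_right πX))
  · obtain ⟨z, rfl⟩ := mk_surjective (IX := IX) (X := X) hp z
    ext1 ξ
    rw [LinearMap.add_apply, ← hS.isPoissonMap.map_sharp, ← hV'.map_sharp, ← hH'.map_sharp, ← map_add]
    refine congrArg (mfderiv (IP.prod IX) (IM.prod IX) (mk IX X hp) z) ?_
    exact Prod.ext (LinearMap.congr_fun (hadd z.1) (restrictFst z _)) (add_zero _).symm
  · obtain ⟨z, rfl⟩ := mk_surjective (IX := IX) (X := X) hp z
    rintro _ ⟨ξ, rfl⟩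
    exact (mfderiv_proj_apply hV' z ξ).trans (hVV z.1 ⟨_, rfl⟩)
  · obtain ⟨z, rfl⟩ := mk_surjective (IX := IX) (X := X) hp z
    rw [eq_bot_iff]
    rintro _ ⟨⟨ξ, rfl⟩, hv⟩
    have h1 : πH z.1 (restrictFst z
        (covectorPullback (IP.prod IX) (IM.prod IX) (mk IX X hp) z ξ)) ∈
        LinearMap.range (πH z.1) ⊓ verticalSpace IP IM p z.1 :=
      ⟨⟨_, rfl⟩, (mfderiv_proj_apply hH' z ξ).symm.trans hv⟩
    rw [hHV, Submodule.mem_bot] at h1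
    rw [Submodule.mem_bot, ← hH'.map_sharp]
    refine Eq.trans ?_ (map_zero (mfderiv (IP.prod IX) (IM.prod IX) (mk IX X hp) z))
    exact congrArg (mfderiv (IP.prod IX) (IM.prod IX) (mk IX X hp) z) (Prod.ext h1 rfl)

end AssociatedPoisson

theorem mainTheorem9
    {EG : Type*} [NormedAddCommGroup EG] [NormedSpace ℝ EG] [FiniteDimensional ℝ EG]
    {HG : Type*} [TopologicalSpace HG] {IG : ModelWithCorners ℝ EG HG} [IG.Boundaryless]
    {EP : Type*} [NormedAddCommGroup EP] [NormedSpace ℝ EP] [FiniteDimensional ℝ EP]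
    {HP : Type*} [TopologicalSpace HP] {IP : ModelWithCorners ℝ EP HP} [IP.Boundaryless]
    {EM : Type*} [NormedAddCommGroup EM] [NormedSpace ℝ EM] [FiniteDimensional ℝ EM]
    {HM : Type*} [TopologicalSpace HM] {IM : ModelWithCorners ℝ EM HM} [IM.Boundaryless]
    {EX : Type*} [NormedAddCommGroup EX] [NormedSpace ℝ EX] [FiniteDimensional ℝ EX]
    {HX : Type*} [TopologicalSpace HX] {IX : ModelWithCorners ℝ EX HX} [IX.Boundaryless]
    -- a Lie group `G` and smooth manifolds `P`, `M`, `X`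
    {G : Type*} [TopologicalSpace G] [ChartedSpace HG G] [Group G] [LieGroup IG ∞ G]
    {P : Type*} [TopologicalSpace P] [ChartedSpace HP P] [IsManifold IP ∞ P]
    {M : Type*} [TopologicalSpace M] [ChartedSpace HM M] [IsManifold IM ∞ M]
    {X : Type*} [TopologicalSpace X] [ChartedSpace HX X] [IsManifold IX ∞ X] [Nonempty X]
    -- a right principal `G`-bundle `p : P → M` and a smooth left action of `G` on `X`
    [MulAction Gᵐᵒᵖ P] [MulAction G X] [ContMDiffSMul IG IX ∞ G X]
    {p : P → M} (hp : IsPrincipalBundle IG IP IM (G := G) p)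
    -- a `G`-invariant Poisson structure on `P`
    (πP : Bivector IP P) (hπP : πP.IsPoisson)
    (hinv : ∀ g : G, IsPoissonMap (fun y : P => MulOpposite.op g • y) πP πP)
    -- a Poisson structure on `X`, on which `G` acts by Poisson diffeomorphisms
    (πX : Bivector IX X) (hπX : πX.IsPoisson)
    (hact : ∀ g : G, IsPoissonMap (fun x : X => g • x) πX πX) :
    ∃ (πM : Bivector IM M) (πS : Bivector (IM.prod IX) (AssociatedBundle hp IX X)),
      IsPoissonSubmersion (AssociatedBundle.mk IX X hp) (πP.prod πX) πS ∧
      IsPoissonSubmersion (Prod.fst : P × X → P) (πP.prod πX) πP ∧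
      IsPoissonSubmersion p πP πM ∧
      IsPoissonSubmersion (AssociatedBundle.proj IX X hp) πS πM ∧
      (IsCoregularSubmersion p πP πM →
        IsCoregularSubmersion (AssociatedBundle.proj IX X hp) πS πM) ∧
      (IsOrthogonalPencil p πP πM →
        IsOrthogonalPencil (AssociatedBundle.proj IX X hp) πS πM) := by
  have hq := AssociatedBundle.isOrbitMap_mk (IX := IX) (X := X) hp
  have hfst : IsPoissonSubmersion (Prod.fst : P × X → P) (πP.prod πX) πP :=
    { isPoisson_source := hπP.prod hπX
      isPoisson_target := hπP
      surjective := Prod.fst_surjective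
      submersion := fun z v => ⟨((v : EP), (0 : EX)),
        DFunLike.congr_fun (mfderiv_fst (I := IP) (I' := IX) (x := z)) _⟩
      isPoissonMap := isPoissonMap_fst πP πX }
  have hpsub := (hp.isOrbitMap.isPoissonMap_pushforward hinv).isPoissonSubmersion hp.isOrbitMap hπP
  have hqsub := (hq.isPoissonMap_pushforward fun g =>
    (hinv g⁻¹).prodMap (hact g)).isPoissonSubmersion hq (hπP.prod hπX)
  exact ⟨_, _, hqsub, hfst, hpsub, isPoissonSubmersion_proj hpsub hqsub,
    fun h => isCoregularSubmersion_proj h hqsub,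
    fun h => isOrthogonalPencil_proj hinv hπX hact h hqsub⟩
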